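/- Let $G$ be a locally compact Hausdorff totally disconnected topological group, let $H$ be a closed subgroup of $G$, and fix right Haar measures $dg$ on $G$ and $dh$ on $H$. Let $\delta_G:G\to\mathbb{R}_{>0}$ be the modular character normalized by $\int_G f(g^{-1}x)\,dx=\delta_G(g)\int_G f(x)\,dx$, and define $\delta_H$ similarly. Let $\mathcal{H}(G)$ be the Hecke algebra of locally constant compactly supported functions $G\to\mathbb{C}$ with the convolution $(f_1*f_2)(g)=\int_G f_1(gx^{-1})f_2(x)\,dx$, and define $\mathcal{H}(H)$ similarly. The algebra $\mathcal{H}(H)$ acts on $\mathcal{H}(G)$ from the right by $(f\phi)(g)=\int_H f(gh^{-1})\phi(h)\,dh$. A smooth representation $(\pi,V)$ of $G$ (a complex representation in which every vector has open stabilizer) is a left $\mathcal{H}(G)$-module via $fv=\int_G f(g)\pi(g)v\,dg$, and similarly for $H$. Let $(\sigma,W)$ be a smooth representation of $H$. Let $\mathcal{H}(G)\otimes_{\mathcal{H}(H)}W$ be the quotient of $\mathcal{H}(G)\otimes_{\mathbb{C}}W$ by the subspace spanned by all $f\phi\otimes w-f\otimes\phi w$ with $f\in\mathcal{H}(G)$,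 $\phi\in\mathcal{H}(H)$, $w\in W$; it is a left $\mathcal{H}(G)$-module via $f'(f\otimes w)=(f'*f)\otimes w$. For a smooth representation $(\tau,W)$ of $H$, let $\mathrm{ind}_H^G(\tau)$ be the space of locally constant functions $F:G\to W$ such that $F(hg)=\tau(h)F(g)$ for all $h\in H$, $g\in G$, and $F$ is supported in $HC$ for some compact $C\subseteq G$, with $G$ acting by right translation; this is a smooth representation of $G$, hence an $\mathcal{H}(G)$-module. Then the formula $$\alpha(f\otimes w)(g)=\frac{1}{\delta_G(g)}\int_H f(g^{-1}h^{-1})\,\delta_H(h^{-1})\,\sigma(h^{-1})w\,dh\qquad(f\in\mathcal{H}(G),\ w\in W,\ g\in G)$$ gives a well-defined linear map, and it is an isomorphism of left $\mathcal{H}(G)$-modules $$\alpha:\mathcal{H}(G)\otimes_{\mathcal{H}(H)}W\;\xrightarrow{\ \sim\ }\;\mathrm{ind}_H^G\!\left(\sigma\otimes\frac{\delta_H}{\delta_G}\right).$$ -/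

import Mathlib

open MeasureTheory TensorProduct Topology
open scoped Pointwise NNReal

noncomputable section

namespace HeckeInduction

section Hecke

variable {G : Type*} [Group G] [TopologicalSpace G]

/-- The subspace of `G → ℂ` of locally constant, compactly supported functions. -/
def heckeSubmodule (G : Type*) [TopologicalSpace G] : Submodule ℂ (G → ℂ) where
  carrier := {f | IsLocallyConstant f ∧ HasCompactSupport f}
  add_mem' := fun ⟨h1, h2⟩ ⟨h3, h4⟩ => ⟨h1.add h3, h2.add h4⟩
  zero_mem' := ⟨IsLocallyConstant.const 0, HasCompactSupport.zero⟩
  smul_mem' := fun c _ ⟨h1, h2⟩ => ⟨h1.comp (c * ·), h2.mul_left⟩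

/-- The space `𝓗(G)` of locally constant, compactly supported functions `G → ℂ`. -/
def Hecke (G : Type*) [TopologicalSpace G] : Type _ := heckeSubmodule G

instance (X : Type*) [TopologicalSpace X] : AddCommGroup (Hecke X) :=
  inferInstanceAs (AddCommGroup (heckeSubmodule X))

instance (X : Type*) [TopologicalSpace X] : Module ℂ (Hecke X) :=
  inferInstanceAs (Module ℂ (heckeSubmodule X))

instance (X : Type*) [TopologicalSpace X] : FunLike (Hecke X) X ℂ where
  coe f := Subtype.val f
  coe_injective _ _ h := Subtype.ext h

lemma Hecke.isLocallyConstant {X : Type*} [TopologicalSpace X] (f : Hecke X) :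
    IsLocallyConstant (f : X → ℂ) := (Subtype.property f).1

lemma Hecke.continuous {X : Type*} [TopologicalSpace X] (f : Hecke X) :
    Continuous (f : X → ℂ) := f.isLocallyConstant.continuous

lemma Hecke.hasCompactSupport {X : Type*} [TopologicalSpace X] (f : Hecke X) :
    HasCompactSupport (f : X → ℂ) := (Subtype.property f).2

/-- A locally constant compactly supported function on a group is invariant under left
translation by all elements of some neighbourhood of `1`. -/
lemma Hecke.eventually_left_invariant [IsTopologicalGroup G] (f : Hecke G) :
    ∀ᶠ u in 𝓝 (1 : G), ∀ g : G, f (u * g) = f g := by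
  have key : ∀ᶠ u in 𝓝 (1 : G), ∀ g ∈ tsupport (f : G → ℂ),
      f (u * g) = f g := by
    refine IsCompact.eventually_forall_of_forall_eventually f.hasCompactSupport ?_
    intro g _
    have h1 : ∀ᶠ z : G × G in 𝓝 (1, g), f (z.1 * z.2) = f (1 * g) :=
      (continuous_mul.tendsto ((1 : G), g)).eventually (f.isLocallyConstant.eventually_eq (1 * g))
    have h2 : ∀ᶠ z : G × G in 𝓝 (1, g), (f : G → ℂ) z.2 = f g :=
      (continuous_snd.tendsto ((1 : G), g)).eventually (f.isLocallyConstant.eventually_eq g)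
    filter_upwards [h1, h2] with z hz1 hz2
    rw [hz1, hz2, one_mul]
  have key' : ∀ᶠ u in 𝓝 (1 : G), ∀ g ∈ tsupport (f : G → ℂ),
      f (u⁻¹ * g) = f g := by
    have : Filter.Tendsto (fun u : G => u⁻¹) (𝓝 1) (𝓝 1) := by
      simpa using (continuous_inv.tendsto (1 : G))
    exact this.eventually key
  filter_upwards [key, key'] with u h1 h2 g
  by_cases hg : g ∈ tsupport (f : G → ℂ)
  · exact h1 g hg
  by_cases hg' : u * g ∈ tsupport (f : G → ℂ)
  · have := h2 _ hg'
    rw [inv_mul_cancel_left] at this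
    exact this.symm
  · rw [image_eq_zero_of_notMem_tsupport hg, image_eq_zero_of_notMem_tsupport hg']

/-- The function `g ↦ ∫ f(g ι(x)⁻¹) φ(x) dν(x)` lies in `𝓗(G)`; both the convolution on `𝓗(G)` and
the right action of `𝓗(H)` on `𝓗(G)` are of this form. -/
lemma convolution_mem [IsTopologicalGroup G] [T2Space G] {X : Type*} [Group X]
    [TopologicalSpace X] [MeasurableSpace X] (ι : X →* G) (hι : Continuous ι)
    (ν : Measure X) (f : Hecke G) (φ : Hecke X) :
    (fun g : G => ∫ x, f (g * (ι x)⁻¹) * φ x ∂ν) ∈ heckeSubmodule G := by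
  constructor
  · rw [IsLocallyConstant.iff_eventually_eq]
    intro g
    have h : Filter.Tendsto (fun y : G => y * g⁻¹) (𝓝 g) (𝓝 1) := by
      have : Continuous fun y : G => y * g⁻¹ := by fun_prop
      simpa using this.tendsto g
    filter_upwards [h.eventually (Hecke.eventually_left_invariant f)] with y hy
    congr 1
    ext x
    have := hy (g * (ι x)⁻¹)
    rw [← this]
    congr 2
    group
  · refine HasCompactSupport.intro
      ((Hecke.hasCompactSupport f).isCompact.mul ((Hecke.hasCompactSupport φ).isCompact.image hι)) ?_
    intro g hg
    rw [← integral_zero X ℂ (μ := ν)]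
    congr 1
    ext x
    by_cases hx : x ∈ tsupport (φ : X → ℂ)
    · have : g * (ι x)⁻¹ ∉ tsupport (f : G → ℂ) := by
        intro h
        exact hg ⟨_, h, ι x, ⟨x, hx, rfl⟩, by group⟩
      rw [image_eq_zero_of_notMem_tsupport this, zero_mul]
    · rw [image_eq_zero_of_notMem_tsupport hx, mul_zero]

/-- The convolution `(f₁ * f₂)(g) = ∫_G f₁(g x⁻¹) f₂(x) dμ(x)` on `𝓗(G)`. -/
def conv [IsTopologicalGroup G] [T2Space G] [MeasurableSpace G] (μ : Measure G)
    (f₁ f₂ : Hecke G) : Hecke G :=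
  ⟨fun g => ∫ x, f₁ (g * x⁻¹) * f₂ x ∂μ,
    convolution_mem (MonoidHom.id G) continuous_id μ f₁ f₂⟩

/-- The right action `(f φ)(g) = ∫_H f(g h⁻¹) φ(h) dν(h)` of `𝓗(H)` on `𝓗(G)`. -/
def rightAct [IsTopologicalGroup G] [T2Space G] [MeasurableSpace G] {H : Subgroup G}
    (ν : Measure H) (f : Hecke G) (φ : Hecke H) : Hecke G :=
  ⟨fun g => ∫ h : H, f (g * (h : G)⁻¹) * φ h ∂ν,
    convolution_mem H.subtype continuous_subtype_val ν f φ⟩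

lemma integrable_conv [IsTopologicalGroup G] [MeasurableSpace G] [BorelSpace G] (μ : Measure G)
    [IsFiniteMeasureOnCompacts μ] (f₁ f₂ : Hecke G) (g : G) :
    Integrable (fun x => f₁ (g * x⁻¹) * f₂ x) μ := by
  have h1 := Hecke.continuous f₁
  have h2 := Hecke.continuous f₂
  refine Continuous.integrable_of_hasCompactSupport (by fun_prop) ?_
  exact (Hecke.hasCompactSupport f₂).mul_left

/-- Left convolution by `f₁` as a linear endomorphism of `𝓗(G)`. -/
def convLeft [IsTopologicalGroup G] [T2Space G] [MeasurableSpace G] [BorelSpace G]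
    (μ : Measure G) [IsFiniteMeasureOnCompacts μ] (f₁ : Hecke G) : Hecke G →ₗ[ℂ] Hecke G where
  toFun := conv μ f₁
  map_add' := fun a b => by
    refine DFunLike.ext _ _ fun g => ?_
    change ∫ x, f₁ (g * x⁻¹) * (a x + b x) ∂μ = _ + _
    simp only [mul_add]
    exact integral_add (integrable_conv μ f₁ a g) (integrable_conv μ f₁ b g)
  map_smul' := fun c a => by
    refine DFunLike.ext _ _ fun g => ?_
    change ∫ x, f₁ (g * x⁻¹) * (c * a x) ∂μ = c * conv μ f₁ a g
    rw [show (c * conv μ f₁ a g)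
      = ∫ x, c * (f₁ (g * x⁻¹) * a x) ∂μ from (integral_const_mul _ _).symm]
    congr 1
    ext x
    ring

/-- The left action of `𝓗(G)` and the right action of `𝓗(H)` on `𝓗(G)` commute. -/
lemma conv_rightAct [IsTopologicalGroup G] [T2Space G] [MeasurableSpace G] [BorelSpace G]
    (μ : Measure G) [IsFiniteMeasureOnCompacts μ] [μ.IsMulRightInvariant] {H : Subgroup G}
    (ν : Measure H) [IsFiniteMeasureOnCompacts ν] (f' f : Hecke G) (φ : Hecke H) :
    conv μ f' (rightAct ν f φ) = rightAct ν (conv μ f' f) φ := by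
  refine DFunLike.ext _ _ fun g => ?_
  change ∫ x, f' (g * x⁻¹) *
      (∫ h : H, f (x * (h : G)⁻¹) * φ h ∂ν) ∂μ
    = ∫ h : H, (∫ x, f' (g * (h : G)⁻¹ * x⁻¹) * f x ∂μ) * φ h ∂ν
  have hL : ∀ x : G, f' (g * x⁻¹) *
      (∫ h : H, f (x * (h : G)⁻¹) * φ h ∂ν)
      = ∫ h : H, f' (g * x⁻¹) *
        (f (x * (h : G)⁻¹) * φ h) ∂ν :=
    fun x => (integral_const_mul _ _).symm
  have hR : ∀ h : H, (∫ x, f' (g * (h : G)⁻¹ * x⁻¹) * f x ∂μ)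
      * φ h
      = ∫ x, f' (g * x⁻¹) * (f (x * (h : G)⁻¹) * φ h) ∂μ := by
    intro h
    rw [← integral_mul_const, ← integral_mul_right_eq_self _ ((h : G)⁻¹)]
    congr 1
    ext x
    rw [mul_assoc]
    congr 2
    group
  simp only [hL, hR]
  refine integral_integral_swap_of_hasCompactSupport
    (f := fun (x : G) (h : H) => f' (g * x⁻¹) *
        (f (x * (h : G)⁻¹) * φ h)) ?_ ?_
  · have h1 := Hecke.continuous f'
    have h2 := Hecke.continuous f
    have h3 := Hecke.continuous φ
    unfold Function.uncurry
    fun_prop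
  · refine HasCompactSupport.intro
      (K := (tsupport (f : G → ℂ) * (Subtype.val '' tsupport (φ : H → ℂ))) ×ˢ
        tsupport (φ : H → ℂ)) ?_ ?_
    · exact ((Hecke.hasCompactSupport f).isCompact.mul
        ((Hecke.hasCompactSupport φ).isCompact.image continuous_subtype_val)).prod
        (Hecke.hasCompactSupport φ).isCompact
    · rintro ⟨x, h⟩ hxh
      simp only [Function.uncurry]
      by_cases hh : h ∈ tsupport (φ : H → ℂ)
      · have : x * (h : G)⁻¹ ∉ tsupport (f : G → ℂ) := by
          intro hx
          exact hxh ⟨⟨_, hx, (h : G), ⟨h, hh, rfl⟩, by simp⟩, hh⟩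
        rw [image_eq_zero_of_notMem_tsupport this]
        ring
      · rw [image_eq_zero_of_notMem_tsupport hh]
        ring

end Hecke

section Smooth

/-- The integral `∫ F dμ` of a locally constant compactly supported function with values in a
complex vector space (without topology): the sum over the finitely many nonzero values `v` of `F`
of `μ(F⁻¹(v)) v`. -/
def lcIntegral {X V : Type*} [MeasurableSpace X] [AddCommGroup V] [Module ℂ V]
    (μ : Measure X) (F : X → V) : V :=
  ∑ᶠ v : V, ((μ.real (F ⁻¹' {v}) : ℝ) : ℂ) • v

/-- A representation is smooth if every vector has open stabilizer. -/
def IsSmoothRep {X V : Type*} [Group X] [TopologicalSpace X] [AddCommGroup V] [Module ℂ V]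
    (π : Representation ℂ X V) : Prop :=
  ∀ v : V, IsOpen {x : X | π x v = v}

/-- The action `f • v = ∫ f(x) π(x) v dμ(x)` of `𝓗(X)` on a smooth representation `π` of `X`. -/
def heckeAct {X V : Type*} [Group X] [TopologicalSpace X] [MeasurableSpace X] [AddCommGroup V]
    [Module ℂ V] (μ : Measure X) (π : Representation ℂ X V) (f : Hecke X) (v : V) : V :=
  lcIntegral μ fun x => f x • π x v

/-- The twist `π ⊗ χ` of a representation by a character. -/
def twist {X V : Type*} [Group X] [AddCommGroup V] [Module ℂ V]
    (π : Representation ℂ X V) (χ : X →* ℂ) : Representation ℂ X V where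
  toFun := fun x => χ x • π x
  map_one' := by simp
  map_mul' := fun x y => by
    ext v
    simp [mul_smul, smul_comm (χ x) (χ y)]

end Smooth

section ModularCharacter

/-- A closed subgroup of a locally compact group is locally compact. -/
instance closedSubgroup_locallyCompactSpace {G : Type*} [Group G] [TopologicalSpace G]
    [LocallyCompactSpace G] (H : Subgroup G) [hH : IsClosed (H : Set G)] :
    LocallyCompactSpace H :=
  hH.isClosedEmbedding_subtypeVal.locallyCompactSpace

/-- The modular character `δ_X`, with complex values. See `integral_inv_mul_eq_modChar` for its
normalization. -/
def modChar (X : Type*) [Group X] [TopologicalSpace X] [IsTopologicalGroup X]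
    [LocallyCompactSpace X] : X →* ℂ :=
  ((Complex.ofRealHom : ℝ →* ℂ).comp (NNReal.toRealHom : ℝ≥0 →* ℝ)).comp
    Measure.modularCharacter

/-- For a right Haar measure `dx`, one has `∫ f(g⁻¹ x) dx = δ(g) ∫ f(x) dx` for `f` in `𝓗(X)`. -/
lemma integral_inv_mul_eq_modChar {X : Type*} [Group X] [TopologicalSpace X]
    [IsTopologicalGroup X] [LocallyCompactSpace X] [MeasurableSpace X] [BorelSpace X]
    (μ : Measure X) [IsFiniteMeasureOnCompacts μ] [μ.IsOpenPosMeasure] [μ.IsMulRightInvariant]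
    (f : Hecke X) (g : X) :
    ∫ x, f (g⁻¹ * x) ∂μ = modChar X g * ∫ x, f x ∂μ := by
  have hpos : (μ.inv).IsHaarMeasure :=
    { lt_top_of_isCompact := fun K hK => by
        rw [Measure.inv_apply]
        exact hK.inv.measure_lt_top
      open_pos := fun U hU hne => by
        rw [Measure.inv_apply]
        exact hU.inv.measure_ne_zero _ hne.inv }
  have real_case : ∀ F : X → ℝ, Continuous F → HasCompactSupport F →
      ∫ x, F (g⁻¹ * x) ∂μ = Measure.modularCharacter g * ∫ x, F x ∂μ := by
    intro F hF hF'
    have e : ∀ F' : X → ℝ, ∫ x, F' x ∂μ = ∫ x, F' x⁻¹ ∂μ.inv := by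
      intro F'
      have := (MeasurableEquiv.inv X).measurableEmbedding.integral_map (μ := μ) (fun x => F' x⁻¹)
      simpa [Measure.inv] using this.symm
    rw [e, e]
    have hc : Continuous fun x => F x⁻¹ := hF.comp continuous_inv
    have hs : HasCompactSupport fun x => F x⁻¹ := hF'.comp_homeomorph (Homeomorph.inv X)
    have h1 := Measure.integral_isMulLeftInvariant_eq_smul_of_hasCompactSupport
      (Measure.map (· * g) μ.inv) μ.inv hc hs
    rw [← Measure.modularCharacterFun_eq_haarScalarFactor,
      (measurableEmbedding_mulRight g).integral_map, integral_smul_nnreal_measure] at h1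
    simp only [mul_inv_rev] at h1
    rw [h1]
    rfl
  have hc := Hecke.continuous f
  have hs := Hecke.hasCompactSupport f
  have hcg : Continuous fun x => f (g⁻¹ * x) := by fun_prop
  have hsg : HasCompactSupport fun x => f (g⁻¹ * x) :=
    hs.comp_homeomorph (Homeomorph.mulLeft g⁻¹)
  have hi := hc.integrable_of_hasCompactSupport (μ := μ) hs
  have hig := hcg.integrable_of_hasCompactSupport (μ := μ) hsg
  have hre := real_case (fun x => (f x).re) (by fun_prop) (hs.comp_left Complex.zero_re)
  have him := real_case (fun x => (f x).im) (by fun_prop) (hs.comp_left Complex.zero_im)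
  have hm : modChar X g = ((Measure.modularCharacter g : ℝ) : ℂ) := rfl
  rw [hm]
  apply Complex.ext
  · rw [Complex.re_ofReal_mul]
    exact (integral_re hig).symm.trans (hre.trans (congrArg _ (integral_re hi)))
  · rw [Complex.im_ofReal_mul]
    exact (integral_im hig).symm.trans (him.trans (congrArg _ (integral_im hi)))

/-- The character `δ_H / δ_G` of a closed subgroup `H` of `G`. -/
def modQuot {G : Type*} [Group G] [TopologicalSpace G] [IsTopologicalGroup G]
    [LocallyCompactSpace G] (H : Subgroup G) [IsClosed (H : Set G)] : H →* ℂ where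
  toFun := fun h => modChar H h / modChar G h
  map_one' := by simp
  map_mul' := fun h h' => by simp [mul_div_mul_comm]

end ModularCharacter

section CompactInduction

variable {G : Type*} [Group G] [TopologicalSpace G] [IsTopologicalGroup G] {H : Subgroup G}
  {W : Type*} [AddCommGroup W] [Module ℂ W]

/-- The space of `ind_H^G σ`: locally constant `F : G → W` with `F(h g) = σ(h) F(g)`, supported in
`H C` for some compact `C ⊆ G`. -/
def cInd (σ : Representation ℂ H W) : Submodule ℂ (G → W) where
  carrier := {F | (∀ (h : H) (g : G), F ((h : G) * g) = σ h (F g)) ∧ IsLocallyConstant F ∧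
    ∃ C : Set G, IsCompact C ∧ Function.support F ⊆ (H : Set G) * C}
  add_mem' := by
    rintro F F' ⟨h1, h2, C, hC, h3⟩ ⟨h1', h2', C', hC', h3'⟩
    refine ⟨fun h g => by simp [h1, h1'], h2.add h2', C ∪ C', hC.union hC', ?_⟩
    rw [Set.mul_union]
    exact (Function.support_add F F').trans (Set.union_subset_union h3 h3')
  zero_mem' := ⟨fun h g => by simp, IsLocallyConstant.const 0, ∅, isCompact_empty, by simp⟩
  smul_mem' := by
    rintro c F ⟨h1, h2, C, hC, h3⟩
    exact ⟨fun h g => by simp [h1], h2.comp (c • ·), C, hC,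
      (Function.support_const_smul_subset c F).trans h3⟩

/-- The action of `G` on `ind_H^G σ` by right translation, `(g F)(x) = F(x g)`. -/
def cIndRep (σ : Representation ℂ H W) : Representation ℂ G (cInd σ) where
  toFun := fun g =>
    { toFun := fun F => ⟨fun x => (F : G → W) (x * g), by
        obtain ⟨F, h1, h2, C, hC, h3⟩ := F
        refine ⟨fun h x => by simp [mul_assoc, h1], h2.comp_continuous (continuous_mul_const g),
          C * {g⁻¹}, hC.mul isCompact_singleton, ?_⟩
        intro x hx
        obtain ⟨h, hh, c, hc, he⟩ := h3 (show x * g ∈ Function.support F from hx)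
        refine ⟨h, hh, c * g⁻¹, ⟨c, hc, g⁻¹, rfl, rfl⟩, ?_⟩
        have he' : h * c = x * g := he
        change h * (c * g⁻¹) = x
        rw [← mul_assoc, he', mul_inv_cancel_right]⟩
      map_add' := fun _ _ => rfl
      map_smul' := fun _ _ => rfl }
  map_one' := by
    ext F x
    change (F : G → W) (x * 1) = (F : G → W) x
    rw [mul_one]
  map_mul' := fun g g' => by
    ext F x
    change (F : G → W) (x * (g * g')) = (F : G → W) (x * g * g')
    rw [mul_assoc]

/-- The compactly induced representation is smooth, so that it is an `𝓗(G)`-module. -/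
lemma cIndRep_isSmooth (σ : Representation ℂ H W) : IsSmoothRep (cIndRep σ) := by
  rintro ⟨F, h1, h2, C, hC, h3⟩
  have inv_of : ∀ k : G, (∀ c ∈ C, F (c * k) = F c) →
      ∀ x ∈ (H : Set G) * C, F (x * k) = F x := by
    rintro k hk _ ⟨h, hh, c, hc, rfl⟩
    have e1 := h1 ⟨h, hh⟩ (c * k)
    have e2 := h1 ⟨h, hh⟩ c
    simp only at e1 e2 ⊢
    rw [mul_assoc, e1, e2, hk c hc]
  have key : ∀ᶠ k in 𝓝 (1 : G), ∀ c ∈ C, F (c * k) = F c := by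
    refine hC.eventually_forall_of_forall_eventually ?_
    intro c _
    have h1' : ∀ᶠ z : G × G in 𝓝 (1, c), F (z.2 * z.1) = F (c * 1) :=
      ((continuous_snd.mul continuous_fst).tendsto ((1 : G), c)).eventually
        (h2.eventually_eq (c * 1))
    have h2' : ∀ᶠ z : G × G in 𝓝 (1, c), F z.2 = F c :=
      (continuous_snd.tendsto ((1 : G), c)).eventually (h2.eventually_eq c)
    filter_upwards [h1', h2'] with z hz1 hz2
    rw [hz1, hz2, mul_one]
  have key' : ∀ᶠ k in 𝓝 (1 : G), ∀ c ∈ C, F (c * k⁻¹) = F c := by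
    have : Filter.Tendsto (fun u : G => u⁻¹) (𝓝 1) (𝓝 1) := by
      simpa using (continuous_inv.tendsto (1 : G))
    exact this.eventually key
  have all : ∀ᶠ k in 𝓝 (1 : G), ∀ x, F (x * k) = F x := by
    filter_upwards [key, key'] with k hk hk' x
    by_cases hx : x ∈ (H : Set G) * C
    · exact inv_of k hk x hx
    by_cases hx' : x * k ∈ (H : Set G) * C
    · have := inv_of _ hk' _ hx'
      rw [mul_inv_cancel_right] at this
      exact this.symm
    · rw [Function.notMem_support.mp fun h => hx (h3 h),
        Function.notMem_support.mp fun h => hx' (h3 h)]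
  rw [isOpen_iff_eventually]
  intro g hg
  have ht : Filter.Tendsto (fun y : G => g⁻¹ * y) (𝓝 g) (𝓝 1) := by
    have : Continuous fun y : G => g⁻¹ * y := by fun_prop
    simpa using this.tendsto g
  filter_upwards [ht.eventually all] with y hy
  have hg' : ∀ x, F (x * g) = F x := fun x => congrFun (congrArg Subtype.val hg) x
  apply Subtype.ext
  funext x
  change F (x * y) = F x
  have := hy (x * g)
  rw [show x * g * (g⁻¹ * y) = x * y by group] at this
  rw [this, hg']

end CompactInduction

section HeckeTensor

variable {G : Type*} [Group G] [TopologicalSpace G] [IsTopologicalGroup G] [T2Space G]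
  [MeasurableSpace G] {H : Subgroup G} {W : Type*} [AddCommGroup W] [Module ℂ W]

/-- The subspace of `𝓗(G) ⊗_ℂ W` spanned by all `f φ ⊗ w - f ⊗ φ w` with `φ` in `𝓗(H)`. -/
def tensorRel (ν : Measure H) (σ : Representation ℂ H W) :
    Submodule ℂ (Hecke G ⊗[ℂ] W) :=
  Submodule.span ℂ {z | ∃ (f : Hecke G) (φ : Hecke H) (w : W),
    z = (rightAct ν f φ) ⊗ₜ[ℂ] w - f ⊗ₜ[ℂ] (heckeAct ν σ φ w)}

/-- The tensor product `𝓗(G) ⊗_{𝓗(H)} W`. -/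
abbrev HeckeTensor (ν : Measure H) (σ : Representation ℂ H W) : Type _ :=
  (Hecke G ⊗[ℂ] W) ⧸ tensorRel ν σ

/-- The class of `f ⊗ w` in `𝓗(G) ⊗_{𝓗(H)} W`. -/
def tmulH (ν : Measure H) (σ : Representation ℂ H W) (f : Hecke G) (w : W) : HeckeTensor ν σ :=
  (tensorRel ν σ).mkQ (f ⊗ₜ[ℂ] w)

/-- The left action of `𝓗(G)` on `𝓗(G) ⊗_{𝓗(H)} W`, `f' (f ⊗ w) = (f' * f) ⊗ w`. -/
def tensorAct [BorelSpace G] (μ : Measure G) [IsFiniteMeasureOnCompacts μ]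
    [μ.IsMulRightInvariant] (ν : Measure H) [IsFiniteMeasureOnCompacts ν]
    (σ : Representation ℂ H W) (f' : Hecke G) : HeckeTensor ν σ →ₗ[ℂ] HeckeTensor ν σ :=
  (tensorRel ν σ).mapQ (tensorRel ν σ) ((convLeft μ f').rTensor W) <| by
    rw [tensorRel, Submodule.span_le]
    rintro _ ⟨f, φ, w, rfl⟩
    refine Submodule.subset_span ⟨conv μ f' f, φ, w, ?_⟩
    rw [map_sub, LinearMap.rTensor_tmul, LinearMap.rTensor_tmul]
    change conv μ f' (rightAct ν f φ) ⊗ₜ[ℂ] w - _ = _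
    rw [conv_rightAct]
    rfl

end HeckeTensor

/-- The function
`α(f ⊗ w)(g) = δ_G(g)⁻¹ ∫_H f(g⁻¹ h⁻¹) σ(h⁻¹) w δ_H(h⁻¹) dν(h)`. -/
def alphaFun {G : Type*} [Group G] [TopologicalSpace G] [IsTopologicalGroup G]
    [LocallyCompactSpace G] [MeasurableSpace G] {H : Subgroup G} [IsClosed (H : Set G)]
    {W : Type*} [AddCommGroup W] [Module ℂ W] (ν : Measure H) (σ : Representation ℂ H W)
    (f : Hecke G) (w : W) (g : G) : W :=
  (modChar G g)⁻¹ • lcIntegral ν fun h : H =>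
    (f (g⁻¹ * (h : G)⁻¹) * modChar H h⁻¹) • σ h⁻¹ w

end HeckeInduction

end

open HeckeInduction

noncomputable section

/-! The substitution `h ↦ h⁻¹` absorbs the factor `δ_H(h⁻¹)` (`integral_inv_eq_integral_modChar`)
and turns the formula into α(f ⊗ w)(g) = δ_G(g)⁻¹ · (f_g acting on w), where f_g(h) = f(g⁻¹h) is the
`slice` (`alphaFun_eq_heckeAct`). The algebraic claims follow: (fφ)_g = f_g * φ gives the tensor
relations, and translating g by k ∈ H multiplies by δ_H(k)σ(k)/δ_G(k), which is the twist.
`𝓗(G)`-linearity is Fubini.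

For bijectivity, fix a compact open subgroup K and representatives x_d of K\G/H. Left K-invariant
functions are combinations of the 1_{Kx}, and elements of H move through the tensor sign
(`tmulH_translate`), so every tensor is ∑ 1_{Kx_d} ⊗ w_d for K small. The value of its image at
x_d⁻¹ sees only w_d: it is a nonzero multiple of the average of w_d over H ∩ x_d⁻¹Kx_d
(`alphaMap_doubleCosetSum`).

If the average vanishes, so does 1_{Kx_d} ⊗ w_d, because 1_{Kx_d} absorbs the averaging; this is
injectivity. Conversely, a K-fixed F in the induced space is determined by its values F(x_d⁻¹). Only
finitely many are nonzero, and each is already fixed by σ on H ∩ x_d⁻¹Kx_d, where the twist is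
trivial, so suitable multiples of them serve as the w_d; this is surjectivity. -/

namespace HeckeInduction

/-! ### Integrals of locally constant vector-valued functions -/

section LocallyConstantIntegral

variable {X V : Type*} [TopologicalSpace X] [AddCommGroup V] [Module ℂ V]

lemma finite_range_of_hasCompactSupport {X V : Type*} [TopologicalSpace X] [Zero V] {F : X → V}
    (hF : IsLocallyConstant F)
    (hc : HasCompactSupport F) : (Set.range F).Finite := by
  -- For the discrete topology on `V` the map `F` is continuous, so the image of its compact support
  -- is compact, hence finite.
  let _ : TopologicalSpace V := ⊥
  have _ : DiscreteTopology V := ⟨rfl⟩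
  have h1 : (F '' tsupport F).Finite :=
    isCompact_iff_finite.mp (hc.isCompact.image hF.continuous)
  refine (h1.union (Set.finite_singleton 0)).subset ?_
  rintro _ ⟨x, rfl⟩
  by_cases hx : x ∈ tsupport F
  · exact Or.inl ⟨x, hx, rfl⟩
  · exact Or.inr (image_eq_zero_of_notMem_tsupport hx)

/-- Linear functionals commute with `lcIntegral`. -/
lemma dual_lcIntegral [MeasurableSpace X] [BorelSpace X] (ν : Measure X)
    [IsFiniteMeasureOnCompacts ν] {F : X → V} (hF : IsLocallyConstant F)
    (hc : HasCompactSupport F) (l : Module.Dual ℂ V) :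
    l (lcIntegral ν F) = ∫ x, l (F x) ∂ν := by
  classical
  have hfin := finite_range_of_hasCompactSupport hF hc
  have hm : ∀ v, MeasurableSet (F ⁻¹' {v}) := fun v => (hF.isOpen_fiber v).measurableSet
  have hsum : ∀ x, l (F x) =
      ∑ v ∈ hfin.toFinset, (F ⁻¹' {v}).indicator (fun _ => l v) x := by
    intro x
    rw [Finset.sum_eq_single (F x)]
    · simp
    · intro v _ hv
      exact Set.indicator_of_notMem (fun h => hv (Eq.symm h)) _
    · intro h
      exact absurd (by simp) h
  have hL : lcIntegral ν F = ∑ v ∈ hfin.toFinset, ((ν.real (F ⁻¹' {v}) : ℝ) : ℂ) • v := by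
    refine finsum_eq_sum_of_support_subset _ ?_
    intro v hv
    by_contra hv'
    refine hv ?_
    have : F ⁻¹' {v} = ∅ := by
      ext x
      simp only [Set.mem_preimage, Set.mem_singleton_iff, Set.mem_empty_iff_false, iff_false]
      rintro rfl
      exact hv' (by simp)
    simp [this]
  simp only [hL, map_sum, map_smul, hsum]
  rw [integral_finsetSum]
  · refine Finset.sum_congr rfl fun v _ => ?_
    rw [integral_indicator_const _ (hm v), smul_eq_mul, Complex.real_smul]
  · intro v _
    rw [integrable_indicator_iff (hm v)]
    -- The fibre over `0` may have infinite measure, but the integrand there is `l 0 = 0`; every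
    -- other fibre lies in the compact support.
    by_cases hv : v = 0
    · subst hv
      simp
    · refine integrableOn_const (ne_of_lt ?_)
      refine (measure_mono ?_).trans_lt (hc.isCompact.measure_lt_top (μ := ν))
      rintro x rfl
      exact subset_tsupport F hv

/-- Functionals separate points of a vector space. With `dual_lcIntegral`, this reduces identities
between vector-valued integrals to scalar ones. -/
lemma eq_of_forall_dual {v w : V} (h : ∀ l : Module.Dual ℂ V, l v = l w) : v = w := by
  rw [← sub_eq_zero, ← Module.forall_dual_apply_eq_zero_iff ℂ]
  intro l
  rw [map_sub, h, sub_self]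

end LocallyConstantIntegral

/-! ### Constructions in `𝓗(X)` -/

lemma isLocallyConstant_indicator {X : Type*} [TopologicalSpace X] {S : Set X}
    (hS : IsClopen S) : IsLocallyConstant (S.indicator (1 : X → ℂ)) := by
  rw [IsLocallyConstant.iff_eventually_eq]
  intro x
  by_cases hx : x ∈ S
  · filter_upwards [hS.isOpen.mem_nhds hx] with y hy
    rw [Set.indicator_of_mem hx, Set.indicator_of_mem hy, Pi.one_apply, Pi.one_apply]
  · filter_upwards [hS.compl.isOpen.mem_nhds hx] with y hy
    rw [Set.indicator_of_notMem hx, Set.indicator_of_notMem hy]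

namespace Hecke

variable {X : Type*} [TopologicalSpace X]

/-- A locally constant compactly supported function, as an element of `𝓗(X)`. -/
def ofFun (f : X → ℂ) (h1 : IsLocallyConstant f) (h2 : HasCompactSupport f) : Hecke X :=
  ⟨f, h1, h2⟩

@[simp] lemma ofFun_apply (f : X → ℂ) (h1 : IsLocallyConstant f) (h2 : HasCompactSupport f)
    (x : X) : ofFun f h1 h2 x = f x := rfl

@[simp] lemma add_apply (f f' : Hecke X) (x : X) : (f + f') x = f x + f' x := rfl

@[simp] lemma smul_apply (c : ℂ) (f : Hecke X) (x : X) : (c • f) x = c * f x := rfl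

@[simp] lemma zero_apply (x : X) : (0 : Hecke X) x = 0 := rfl

lemma sum_apply {ι : Type*} (s : Finset ι) (f : ι → Hecke X) (x : X) :
    (∑ i ∈ s, f i) x = ∑ i ∈ s, f i x := by
  classical
  induction s using Finset.induction_on with
  | empty => simp
  | insert a s ha ih => rw [Finset.sum_insert ha, Finset.sum_insert ha, add_apply, ih]

/-- The characteristic function of a compact open set. -/
def ind [T2Space X] (S : Set X) (ho : IsOpen S) (hc : IsCompact S) : Hecke X :=
  ofFun (S.indicator 1) (isLocallyConstant_indicator ⟨hc.isClosed, ho⟩)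
    (HasCompactSupport.intro hc fun _ hx => Set.indicator_of_notMem hx _)

lemma ind_of_mem [T2Space X] {S : Set X} (ho : IsOpen S) (hc : IsCompact S) {x : X}
    (hx : x ∈ S) : ind S ho hc x = 1 := Set.indicator_of_mem hx _

lemma ind_of_notMem [T2Space X] {S : Set X} (ho : IsOpen S) (hc : IsCompact S) {x : X}
    (hx : x ∉ S) : ind S ho hc x = 0 := Set.indicator_of_notMem hx _

lemma integral_ind [T2Space X] [MeasurableSpace X] [BorelSpace X] (μ : Measure X)
    {S : Set X} (ho : IsOpen S) (hc : IsCompact S) :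
    ∫ x, ind S ho hc x ∂μ = (μ.real S : ℂ) := by
  change ∫ x, S.indicator (fun _ => (1 : ℂ)) x ∂μ = _
  rw [integral_indicator_const _ ho.measurableSet, Complex.real_smul, mul_one]

lemma integral_ind_ne_zero [T2Space X] [MeasurableSpace X] [BorelSpace X] (μ : Measure X)
    [IsFiniteMeasureOnCompacts μ] [μ.IsOpenPosMeasure]
    {S : Set X} (ho : IsOpen S) (hc : IsCompact S) (hne : S.Nonempty) :
    ∫ x, ind S ho hc x ∂μ ≠ 0 := by
  rw [integral_ind, Complex.ofReal_ne_zero, Measure.real, ENNReal.toReal_ne_zero]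
  exact ⟨ho.measure_ne_zero _ hne, hc.measure_lt_top.ne⟩

/-- The product of an element of `𝓗(X)` with a locally constant function. -/
def mulLC (f : Hecke X) (u : X → ℂ) (hu : IsLocallyConstant u) : Hecke X :=
  ofFun (fun x => f x * u x) (f.isLocallyConstant.mul hu) f.hasCompactSupport.mul_right

@[simp] lemma mulLC_apply (f : Hecke X) (u : X → ℂ) (hu : IsLocallyConstant u) (x : X) :
    mulLC f u hu x = f x * u x := rfl

/-- The composition of an element of `𝓗(X)` with a closed embedding. -/
def comp {Y : Type*} [TopologicalSpace Y] (f : Hecke X) (i : Y → X)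
    (hi : IsClosedEmbedding i) : Hecke Y :=
  ofFun (fun y => f (i y)) (f.isLocallyConstant.comp_continuous hi.continuous)
    (f.hasCompactSupport.comp_isClosedEmbedding hi)

@[simp] lemma comp_apply {Y : Type*} [TopologicalSpace Y] (f : Hecke X) (i : Y → X)
    (hi : IsClosedEmbedding i) (y : Y) : comp f i hi y = f (i y) := rfl

lemma integrable [MeasurableSpace X] [BorelSpace X] (μ : Measure X)
    [IsFiniteMeasureOnCompacts μ] (f : Hecke X) : Integrable (fun x => f x) μ :=
  f.continuous.integrable_of_hasCompactSupport f.hasCompactSupport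

end Hecke

/-! ### Compact open subgroups and the modular character -/

section CompactOpen

lemma exists_compact_open_subset {X : Type*} [TopologicalSpace X] [LocallyCompactSpace X]
    [T2Space X] [TotallyDisconnectedSpace X] {x : X} {s : Set X} (hs : s ∈ 𝓝 x) :
    ∃ S : Set X, IsOpen S ∧ IsCompact S ∧ x ∈ S ∧ S ⊆ s := by
  obtain ⟨K, hK, hKs, hKc⟩ := local_compact_nhds hs
  obtain ⟨S, hS, hxS, hSK⟩ := loc_compact_Haus_tot_disc_of_zero_dim.mem_nhds_iff.mp hK
  exact ⟨S, hS.2, hKc.of_isClosed_subset hS.1 hSK, hxS, hSK.trans hKs⟩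

variable {X : Type*} [Group X] [TopologicalSpace X] [IsTopologicalGroup X]

/-- Inversion exchanges left and right translation, so this is left invariance of `x ↦ f x⁻¹`. -/
lemma Hecke.eventually_right_invariant (f : Hecke X) :
    ∀ᶠ u in 𝓝 (1 : X), ∀ g : X, f (g * u) = f g := by
  have h := Hecke.eventually_left_invariant
    (f.comp (fun x : X => x⁻¹) (Homeomorph.inv X).isClosedEmbedding)
  have ht : Filter.Tendsto (fun u : X => u⁻¹) (𝓝 1) (𝓝 1) := by
    simpa using (continuous_inv.tendsto (1 : X))
  filter_upwards [ht.eventually h] with u hu g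
  have h' : f (u⁻¹ * g⁻¹)⁻¹ = f g⁻¹⁻¹ := hu g⁻¹
  simpa using h'

variable [LocallyCompactSpace X]

lemma modChar_ne_zero (g : X) : modChar X g ≠ 0 := by
  intro h
  have : modChar X (g * g⁻¹) = 0 := by rw [map_mul, h, zero_mul]
  rw [mul_inv_cancel, map_one] at this
  exact one_ne_zero this

lemma modChar_inv (g : X) : modChar X g⁻¹ = (modChar X g)⁻¹ := by
  refine eq_inv_of_mul_eq_one_left ?_
  rw [← map_mul, inv_mul_cancel, map_one]

variable [T2Space X]

/-- The indicator of `K` is invariant under translation by `k` and has nonzero integral, so the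
translation formula forces `δ(k) = 1`. -/
lemma modChar_eq_one_of_mem [MeasurableSpace X] [BorelSpace X]
    (μ : Measure X) [IsFiniteMeasureOnCompacts μ] [μ.IsOpenPosMeasure] [μ.IsMulRightInvariant]
    {K : Subgroup X} (ho : IsOpen (K : Set X))
    (hc : IsCompact (K : Set X)) {k : X} (hk : k ∈ K) : modChar X k = 1 := by
  have h := integral_inv_mul_eq_modChar μ (Hecke.ind (K : Set X) ho hc) k
  have h' : ∀ x, Hecke.ind (K : Set X) ho hc (k⁻¹ * x) = Hecke.ind (K : Set X) ho hc x := by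
    intro x
    by_cases hx : x ∈ K
    · rw [Hecke.ind_of_mem ho hc hx, Hecke.ind_of_mem ho hc (K.mul_mem (K.inv_mem hk) hx)]
    · rw [Hecke.ind_of_notMem ho hc hx, Hecke.ind_of_notMem ho hc fun h => hx
        ((K.mul_mem_cancel_left (K.inv_mem hk)).mp h)]
  simp only [h'] at h
  exact (mul_eq_right₀ (Hecke.integral_ind_ne_zero μ ho hc ⟨1, K.one_mem⟩)).mp h.symm

variable [TotallyDisconnectedSpace X]

/-- Compact open subgroups form a basis of neighbourhoods of `1`. -/
lemma exists_compact_open_subgroup {s : Set X} (hs : s ∈ 𝓝 1) :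
    ∃ K : Subgroup X, IsOpen (K : Set X) ∧ IsCompact (K : Set X) ∧ (K : Set X) ⊆ s := by
  obtain ⟨S, hSo, hSc, h1, hSs⟩ := exists_compact_open_subset hs
  let f := Hecke.ind S hSo hSc
  -- The stabilizer of the indicator of `S` under left translation; evaluating at `1 ∈ S` shows that
  -- it lies in `S`.
  let K : Subgroup X :=
    { carrier := {u | ∀ g, f (u * g) = f g}
      one_mem' := fun g => by rw [one_mul]
      mul_mem' := fun {a b} ha hb g => by rw [mul_assoc, ha, hb]
      inv_mem' := fun {a} ha g => by rw [← ha, mul_inv_cancel_left] }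
  have hKo : IsOpen (K : Set X) :=
    K.isOpen_of_mem_nhds (g := 1) (Hecke.eventually_left_invariant f)
  have hKS : (K : Set X) ⊆ S := by
    intro u hu
    by_contra hn
    have h := hu 1
    rw [mul_one] at h
    rw [show f u = 0 from Hecke.ind_of_notMem hSo hSc hn,
      show f 1 = 1 from Hecke.ind_of_mem hSo hSc h1] at h
    exact zero_ne_one h
  exact ⟨K, hKo, hSc.of_isClosed_subset (K.isClosed_of_isOpen hKo) hKS, hKS.trans hSs⟩

variable [MeasurableSpace X] [BorelSpace X]

/-- A character trivial on an open subgroup `K` is constant on the open cosets `gK`. -/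
lemma modChar_isLocallyConstant (μ : Measure X) [IsFiniteMeasureOnCompacts μ]
    [μ.IsOpenPosMeasure] [μ.IsMulRightInvariant] : IsLocallyConstant (modChar X) := by
  obtain ⟨K, ho, hc, -⟩ := exists_compact_open_subgroup (X := X) Filter.univ_mem
  rw [IsLocallyConstant.iff_eventually_eq]
  intro g
  have ht : Filter.Tendsto (fun y : X => g⁻¹ * y) (𝓝 g) (𝓝 1) := by
    have : Continuous fun y : X => g⁻¹ * y := by fun_prop
    simpa using this.tendsto g
  filter_upwards [ht.eventually (ho.mem_nhds K.one_mem)] with y hy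
  have h := modChar_eq_one_of_mem μ ho hc hy
  rw [show y = g * (g⁻¹ * y) by group, map_mul, h, mul_one]

end CompactOpen

/-! ### Coset indicators and the inversion formula -/

section Cosets

variable {X : Type*} [Group X] [TopologicalSpace X] [IsTopologicalGroup X] [T2Space X]

/-- The characteristic function of the coset `K x` of a compact open subgroup `K`. -/
def cosetInd (K : Subgroup X) (ho : IsOpen (K : Set X)) (hc : IsCompact (K : Set X)) (x : X) :
    Hecke X :=
  (Hecke.ind (K : Set X) ho hc).comp (fun g => g * x⁻¹)
    (Homeomorph.mulRight x⁻¹).isClosedEmbedding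

variable {K : Subgroup X} (ho : IsOpen (K : Set X)) (hc : IsCompact (K : Set X))

lemma cosetInd_of_mem {x g : X} (h : g * x⁻¹ ∈ K) : cosetInd K ho hc x g = 1 :=
  Hecke.ind_of_mem ho hc h

lemma cosetInd_of_notMem {x g : X} (h : g * x⁻¹ ∉ K) : cosetInd K ho hc x g = 0 :=
  Hecke.ind_of_notMem ho hc h

/-- Left `K`-invariant elements of `𝓗(X)` are combinations of characteristic functions of
cosets. -/
lemma mem_span_cosetInd (f : Hecke X) (hf : ∀ k ∈ K, ∀ g, f (k * g) = f g) :
    f ∈ Submodule.span ℂ (Set.range (cosetInd K ho hc)) := by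
  classical
  obtain ⟨t, ht⟩ := f.hasCompactSupport.isCompact.elim_finite_subcover
    (fun x : X => {g : X | g * x⁻¹ ∈ K})
    (fun x => ho.preimage (continuous_mul_const x⁻¹))
    (fun g _ => Set.mem_iUnion.mpr ⟨g, by simp [K.one_mem]⟩)
  let q : X → Quotient (QuotientGroup.rightRel K) := Quotient.mk _
  have hq : ∀ a b : X, q a = q b ↔ b * a⁻¹ ∈ K := fun a b => by
    rw [← QuotientGroup.rightRel_apply]
    exact Quotient.eq
  -- Finitely many cosets cover the support; `f` is constant on each, with value read off at the
  -- representative `out`.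
  have key : f = ∑ c ∈ t.image q, f c.out • cosetInd K ho hc c.out := by
    refine DFunLike.ext _ _ fun g => ?_
    have hout : g * (q g).out⁻¹ ∈ K := by
      rw [← hq]
      exact Quotient.out_eq _
    have hfg : f (q g).out = f g := by
      have := hf _ hout (q g).out
      rw [inv_mul_cancel_right] at this
      exact this.symm
    rw [Hecke.sum_apply, Finset.sum_eq_single (q g)]
    · rw [Hecke.smul_apply, cosetInd_of_mem ho hc hout, mul_one, hfg]
    · intro c _ hcg
      rw [Hecke.smul_apply, cosetInd_of_notMem ho hc, mul_zero]
      intro h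
      apply hcg
      rw [← hq] at h
      exact (Quotient.out_eq c).symm.trans h
    · intro hg
      have : f g = 0 := by
        by_contra h0
        obtain ⟨x, hx, hgx⟩ := Set.mem_iUnion₂.mp (ht (subset_tsupport _ h0))
        exact hg (Finset.mem_image.mpr ⟨x, hx, (hq x g).mpr hgx⟩)
      rw [Hecke.smul_apply, hfg, this, zero_mul]
  rw [key]
  exact Submodule.sum_mem _ fun c _ => Submodule.smul_mem _ _ (Submodule.subset_span ⟨_, rfl⟩)

variable [LocallyCompactSpace X] [TotallyDisconnectedSpace X] [MeasurableSpace X] [BorelSpace X]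

/-- For a right Haar measure, `∫ f(x⁻¹) dx = ∫ f(x) δ(x)⁻¹ dx`. -/
lemma integral_inv_eq_integral_modChar (μ : Measure X) [IsFiniteMeasureOnCompacts μ]
    [μ.IsOpenPosMeasure] [μ.IsMulRightInvariant] (f : Hecke X) :
    ∫ x, f x⁻¹ ∂μ = ∫ x, f x * (modChar X x)⁻¹ ∂μ := by
  obtain ⟨K, ho, hc, hK⟩ := exists_compact_open_subgroup (X := X) f.eventually_left_invariant
  have hlc : IsLocallyConstant fun x : X => (modChar X x)⁻¹ :=
    (modChar_isLocallyConstant μ).comp (·⁻¹)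
  have h1 : ∀ a : Hecke X, Integrable (fun x => a x⁻¹) μ := fun a =>
    (a.comp (fun x : X => x⁻¹) (Homeomorph.inv X).isClosedEmbedding).integrable μ
  have h2 : ∀ a : Hecke X, Integrable (fun x => a x * (modChar X x)⁻¹) μ := fun a =>
    (a.mulLC _ hlc).integrable μ
  -- Both sides are linear in `f`, so it suffices to treat the indicator of a coset `K x`.
  have hspan := mem_span_cosetInd ho hc f fun k hk => hK hk
  clear hK
  induction hspan using Submodule.span_induction with
  | mem f hf =>
    obtain ⟨x, rfl⟩ := hf
    have e1 : ∀ y, cosetInd K ho hc x y⁻¹ = Hecke.ind (K : Set X) ho hc (x⁻¹⁻¹ * y) := by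
      intro y
      by_cases hy : y⁻¹ * x⁻¹ ∈ K
      · rw [cosetInd_of_mem ho hc hy, Hecke.ind_of_mem ho hc]
        simpa using K.inv_mem hy
      · rw [cosetInd_of_notMem ho hc hy, Hecke.ind_of_notMem ho hc]
        intro h
        exact hy (by simpa using K.inv_mem h)
    simp only [e1]
    -- The left side is the integral of a translate of 1_K by `x⁻¹`, namely `δ(x⁻¹)` times the
    -- volume of `K`. The right side agrees after `y ↦ y x`, since `δ` is constant on `K x`.
    rw [integral_inv_mul_eq_modChar,
      ← integral_mul_right_eq_self (fun y => cosetInd K ho hc x y * (modChar X y)⁻¹) x,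
      ← integral_const_mul]
    congr 1
    ext y
    by_cases hy : y ∈ K
    · rw [cosetInd_of_mem ho hc (by simpa using hy), Hecke.ind_of_mem ho hc hy, map_mul,
        modChar_eq_one_of_mem μ ho hc hy, modChar_inv]
      simp only [one_mul, mul_one]
    · rw [cosetInd_of_notMem ho hc (by simpa using hy), Hecke.ind_of_notMem ho hc hy]
      simp
  | zero => simp
  | add a b _ _ ha hb =>
    simp only [Hecke.add_apply, add_mul]
    rw [integral_add (h1 a) (h1 b), integral_add (h2 a) (h2 b), ha, hb]
  | smul c a _ ha =>
    simp only [Hecke.smul_apply, mul_assoc]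
    rw [integral_const_mul, integral_const_mul, ha]

end Cosets

/-! ### The action of `𝓗(X)` on smooth representations -/

section HeckeAction

variable {X V : Type*} [Group X] [TopologicalSpace X] [IsTopologicalGroup X]
  [AddCommGroup V] [Module ℂ V] {π : Representation ℂ X V}

lemma IsSmoothRep.isLocallyConstant (hπ : IsSmoothRep π) (v : V) :
    IsLocallyConstant fun x => π x v := by
  rw [IsLocallyConstant.iff_eventually_eq]
  intro x
  have ht : Filter.Tendsto (fun y : X => x⁻¹ * y) (𝓝 x) (𝓝 1) := by
    have : Continuous fun y : X => x⁻¹ * y := by fun_prop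
    simpa using this.tendsto x
  filter_upwards [ht.eventually ((hπ v).mem_nhds (by simp))] with y hy
  have hy' : π (x⁻¹ * y) v = v := hy
  rw [show y = x * (x⁻¹ * y) by group, map_mul, Module.End.mul_apply, hy']

lemma IsSmoothRep.isLocallyConstant_dual (hπ : IsSmoothRep π) (l : Module.Dual ℂ V) (v : V) :
    IsLocallyConstant fun x => l (π x v) := (hπ.isLocallyConstant v).comp l

lemma isLocallyConstant_smul_orbit (hπ : IsSmoothRep π) (f : Hecke X) (v : V) :
    IsLocallyConstant fun x => f x • π x v := by
  rw [IsLocallyConstant.iff_eventually_eq]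
  intro x
  filter_upwards [f.isLocallyConstant.eventually_eq x,
    (hπ.isLocallyConstant v).eventually_eq x] with y h1 h2
  rw [h1, h2]

variable [MeasurableSpace X] [BorelSpace X] (ν : Measure X) [IsFiniteMeasureOnCompacts ν]

lemma dual_heckeAct (hπ : IsSmoothRep π) (f : Hecke X) (v : V) (l : Module.Dual ℂ V) :
    l (heckeAct ν π f v) = ∫ x, f x * l (π x v) ∂ν := by
  rw [heckeAct, dual_lcIntegral ν (isLocallyConstant_smul_orbit hπ f v)
    f.hasCompactSupport.smul_right]
  simp only [map_smul, smul_eq_mul]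

lemma integrable_mul_dual (hπ : IsSmoothRep π) (f : Hecke X) (v : V) (l : Module.Dual ℂ V) :
    Integrable (fun x => f x * l (π x v)) ν :=
  (f.mulLC _ (hπ.isLocallyConstant_dual l v)).integrable ν

/-- The action of `𝓗(X)` on a smooth representation as a bilinear map. -/
def heckeActBilin (hπ : IsSmoothRep π) : Hecke X →ₗ[ℂ] V →ₗ[ℂ] V :=
  LinearMap.mk₂ ℂ (heckeAct ν π)
    (fun f f' v => eq_of_forall_dual fun l => by
      rw [map_add, dual_heckeAct ν hπ, dual_heckeAct ν hπ, dual_heckeAct ν hπ,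
        ← integral_add (integrable_mul_dual ν hπ f v l) (integrable_mul_dual ν hπ f' v l)]
      simp only [Hecke.add_apply, add_mul])
    (fun c f v => eq_of_forall_dual fun l => by
      rw [map_smul, dual_heckeAct ν hπ, dual_heckeAct ν hπ, smul_eq_mul, ← integral_const_mul]
      simp only [Hecke.smul_apply, mul_assoc])
    (fun f v v' => eq_of_forall_dual fun l => by
      rw [map_add, dual_heckeAct ν hπ, dual_heckeAct ν hπ, dual_heckeAct ν hπ,
        ← integral_add (integrable_mul_dual ν hπ f v l) (integrable_mul_dual ν hπ f v' l)]
      simp only [map_add, mul_add])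
    (fun c f v => eq_of_forall_dual fun l => by
      rw [map_smul, dual_heckeAct ν hπ, dual_heckeAct ν hπ, smul_eq_mul, ← integral_const_mul]
      simp only [map_smul, smul_eq_mul, mul_left_comm])

@[simp] lemma heckeActBilin_apply (hπ : IsSmoothRep π) (f : Hecke X) (v : V) :
    heckeActBilin ν hπ f v = heckeAct ν π f v := rfl

/-- If `π(x) v = v'` on the support of `f`, then `f` sends `v` to `(∫ f) v'`. -/
lemma heckeAct_of_forall_eq (hπ : IsSmoothRep π) (f : Hecke X) {v v' : V}
    (h : ∀ x, f x ≠ 0 → π x v = v') : heckeAct ν π f v = (∫ x, f x ∂ν) • v' := by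
  refine eq_of_forall_dual fun l => ?_
  rw [dual_heckeAct ν hπ, map_smul, smul_eq_mul, ← integral_mul_const]
  congr 1
  ext x
  by_cases hx : f x = 0
  · rw [hx, zero_mul, zero_mul]
  · rw [h x hx]

/-- `𝓗(X)` acts on smooth representations as an algebra. -/
lemma heckeAct_conv [T2Space X] [ν.IsMulRightInvariant] (hπ : IsSmoothRep π) (f φ : Hecke X)
    (v : V) : heckeAct ν π (conv ν f φ) v = heckeAct ν π f (heckeAct ν π φ v) := by
  refine eq_of_forall_dual fun l => ?_
  rw [dual_heckeAct ν hπ, dual_heckeAct ν hπ]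
  -- Only the scalar coefficient `x ↦ l (π x v)` matters; as an opaque continuous function it leaves
  -- a purely scalar Fubini argument.
  obtain ⟨c, hc⟩ : ∃ c : X → ℂ, ∀ x, l (π x v) = c x := ⟨_, fun _ => rfl⟩
  have hL : ∀ x, conv ν f φ x * l (π x v) = ∫ y, f (x * y⁻¹) * φ y * c x ∂ν :=
    fun x => (hc x).symm ▸ (integral_mul_const _ _).symm
  have hR : ∀ x, f x * l (π x (heckeAct ν π φ v)) = ∫ y, f x * (φ y * c (x * y)) ∂ν := by
    intro x
    rw [integral_const_mul]
    congr 1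
    have := dual_heckeAct ν hπ φ v (l ∘ₗ π x)
    simpa only [LinearMap.comp_apply, ← Module.End.mul_apply, ← map_mul, hc] using this
  simp only [hL, hR]
  have h1 := f.continuous
  have h2 := φ.continuous
  have h3 : Continuous c := by
    simpa only [hc] using (hπ.isLocallyConstant_dual l v).continuous
  -- Swap the integrals, substitute `x ↦ x y` by right invariance, and swap back.
  refine (integral_integral_swap_of_hasCompactSupport (by fun_prop) ?_).trans
    (Eq.trans ?_ (integral_integral_swap_of_hasCompactSupport (by fun_prop) ?_).symm)
  · refine HasCompactSupport.intro ((f.hasCompactSupport.isCompact.mul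
      φ.hasCompactSupport.isCompact).prod φ.hasCompactSupport) ?_
    rintro ⟨x, y⟩ hxy
    simp only [Function.uncurry]
    by_cases hy : y ∈ tsupport (φ : X → ℂ)
    · rw [image_eq_zero_of_notMem_tsupport (f := f) fun hx => hxy ⟨⟨_, hx, y, hy, by simp⟩, hy⟩]
      ring
    · rw [image_eq_zero_of_notMem_tsupport hy]
      ring
  · congr 1
    ext y
    rw [← integral_mul_right_eq_self _ y]
    congr 1
    ext x
    rw [mul_inv_cancel_right, mul_assoc]
  · refine HasCompactSupport.intro (f.hasCompactSupport.isCompact.prod φ.hasCompactSupport) ?_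
    rintro ⟨x, y⟩ hxy
    simp only [Function.uncurry]
    by_cases hx : x ∈ tsupport (f : X → ℂ)
    · rw [image_eq_zero_of_notMem_tsupport (f := φ) fun hy => hxy ⟨hx, hy⟩]
      ring
    · rw [image_eq_zero_of_notMem_tsupport hx]
      ring

/-- Left translation by `k` on `𝓗(X)` changes the action by `δ(k) π(k)`. -/
lemma heckeAct_translate [LocallyCompactSpace X] [ν.IsOpenPosMeasure] [ν.IsMulRightInvariant]
    (hπ : IsSmoothRep π) (f f' : Hecke X) (k : X) (h : ∀ x, f' x = f (k⁻¹ * x)) (v : V) :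
    heckeAct ν π f' v = modChar X k • π k (heckeAct ν π f v) := by
  refine eq_of_forall_dual fun l => ?_
  have e := dual_heckeAct ν hπ f v (l ∘ₗ π k)
  rw [LinearMap.comp_apply] at e
  rw [dual_heckeAct ν hπ, map_smul, e, smul_eq_mul]
  have hlc : IsLocallyConstant fun x => (l ∘ₗ π k) (π x v) :=
    hπ.isLocallyConstant_dual (l ∘ₗ π k) v
  -- The translated function is `x ↦ f x * l (π (k x) v)`: replacing `x` by `k⁻¹ x` removes `k` from
  -- the coefficient and leaves `δ(k)`.
  have := integral_inv_mul_eq_modChar ν (f.mulLC _ hlc) k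
  simp only [Hecke.mulLC_apply, LinearMap.comp_apply, ← Module.End.mul_apply, ← map_mul,
    mul_inv_cancel_left] at this
  simp only [h, this, LinearMap.comp_apply, ← Module.End.mul_apply, ← map_mul]

/-- Convolution in terms of left translates of the second factor. -/
lemma conv_apply_eq [LocallyCompactSpace X] [T2Space X] [TotallyDisconnectedSpace X]
    [ν.IsOpenPosMeasure] [ν.IsMulRightInvariant] (f' f : Hecke X) (y : X) :
    conv ν f' f y = ∫ x, f' x * (modChar X x)⁻¹ * f (x⁻¹ * y) ∂ν := by
  have hlc : IsLocallyConstant fun x => f (x⁻¹ * y) :=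
    f.isLocallyConstant.comp_continuous (by fun_prop)
  -- Inversion is applied to `x ↦ f' x * f (x⁻¹ y)`; a right translation by `y⁻¹` then recovers the
  -- convolution.
  have h := integral_inv_eq_integral_modChar ν (f'.mulLC _ hlc)
  rw [← integral_mul_right_eq_self _ y⁻¹] at h
  simp only [Hecke.mulLC_apply, mul_inv_rev, inv_inv, inv_mul_cancel_right] at h
  change ∫ x, f' (y * x⁻¹) * f x ∂ν = _
  rw [h]
  congr 1
  ext x
  ring

end HeckeAction

/-! ### Relations in the tensor product -/

section TensorRelations

variable {G : Type*} [Group G] [TopologicalSpace G] [IsTopologicalGroup G] [T2Space G]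
  [MeasurableSpace G] {H : Subgroup G} {W : Type*} [AddCommGroup W] [Module ℂ W]
  (ν : Measure H) (σ : Representation ℂ H W)

lemma tmulH_rightAct (f : Hecke G) (φ : Hecke H) (w : W) :
    tmulH ν σ (rightAct ν f φ) w = tmulH ν σ f (heckeAct ν σ φ w) := by
  rw [tmulH, tmulH, ← sub_eq_zero, ← map_sub, Submodule.mkQ_apply, Submodule.Quotient.mk_eq_zero]
  exact Submodule.subset_span ⟨f, φ, w, rfl⟩

/-- `(f, w) ↦ f ⊗ w` as a bilinear map. -/
def tmulHBilin : Hecke G →ₗ[ℂ] W →ₗ[ℂ] HeckeTensor (G := G) ν σ :=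
  (TensorProduct.mk ℂ (Hecke G) W).compr₂ (tensorRel ν σ).mkQ

@[simp] lemma tmulHBilin_apply (f : Hecke G) (w : W) :
    tmulHBilin ν σ f w = tmulH ν σ f w := rfl

lemma heckeTensor_induction {P : HeckeTensor (G := G) ν σ → Prop} (h0 : P 0)
    (ht : ∀ f w, P (tmulH ν σ f w)) (ha : ∀ x y, P x → P y → P (x + y)) (x) : P x := by
  obtain ⟨z, rfl⟩ := Submodule.mkQ_surjective _ x
  induction z using TensorProduct.induction_on with
  | zero => simpa using h0
  | tmul f w => exact ht f w
  | add a b h1 h2 => rw [map_add]; exact ha _ _ h1 h2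

/-- If all translates `f(· x⁻¹)` with `x` in the support of `φ` equal `f'`, then `f φ` is
`(∫ φ) f'`. -/
lemma rightAct_of_forall_eq (f f' : Hecke G) (φ : Hecke H)
    (h : ∀ x : H, φ x ≠ 0 → ∀ g, f (g * (x : G)⁻¹) = f' g) :
    rightAct ν f φ = (∫ x, φ x ∂ν) • f' := by
  refine DFunLike.ext _ _ fun g => ?_
  change ∫ x : H, f (g * (x : G)⁻¹) * φ x ∂ν = (∫ x, φ x ∂ν) * f' g
  rw [mul_comm, ← integral_const_mul]
  congr 1
  ext x
  by_cases hx : φ x = 0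
  · rw [hx, mul_zero, mul_zero]
  · rw [h x hx]

variable [LocallyCompactSpace G] [TotallyDisconnectedSpace G] [BorelSpace G]
  [IsClosed (H : Set G)] [IsFiniteMeasureOnCompacts ν] [ν.IsOpenPosMeasure]

/-- Right translation by `k ∈ H` moves through the tensor product. -/
lemma tmulH_translate {σ : Representation ℂ H W} (hσ : IsSmoothRep σ) (f f' : Hecke G) (k : H)
    (h : ∀ g, f' g = f (g * (k : G)⁻¹)) (w : W) :
    tmulH ν σ f' w = tmulH ν σ f (σ k w) := by
  -- `𝓗(H)` contains no point mass at `k`, but the indicator of a small compact open `S` around `k`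
  -- acts as one, up to its volume, on both `f` and `w`. The volume is then cancelled.
  have hev : ∀ᶠ x : H in 𝓝 k, (∀ g, f (g * (x : G)⁻¹) = f' g) ∧ σ x w = σ k w := by
    refine Filter.Eventually.and ?_ ((hσ.isLocallyConstant w).eventually_eq k)
    have ht : Filter.Tendsto (fun x : H => (k : G) * (x : G)⁻¹) (𝓝 k) (𝓝 1) := by
      have : Continuous fun x : H => (k : G) * (x : G)⁻¹ := by fun_prop
      simpa using this.tendsto k
    filter_upwards [ht.eventually f.eventually_right_invariant] with x hx g
    rw [h, ← hx (g * (k : G)⁻¹), ← mul_assoc, inv_mul_cancel_right]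
  obtain ⟨S, hSo, hSc, hkS, hS⟩ := exists_compact_open_subset hev
  have hmem : ∀ x, Hecke.ind S hSo hSc x ≠ 0 → x ∈ S := fun x hx => by
    by_contra hn
    exact hx (Hecke.ind_of_notMem hSo hSc hn)
  have h1 := tmulH_rightAct ν σ f (Hecke.ind S hSo hSc) w
  rw [rightAct_of_forall_eq ν f f' _ fun x hx => (hS (hmem x hx)).1,
    heckeAct_of_forall_eq ν hσ _ fun x hx => (hS (hmem x hx)).2, ← tmulHBilin_apply,
    ← tmulHBilin_apply, map_smul, map_smul, LinearMap.smul_apply] at h1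
  exact smul_right_injective _ (Hecke.integral_ind_ne_zero ν hSo hSc ⟨k, hkS⟩) h1

end TensorRelations

/-! ### The map `α` and its linearity over `𝓗(G)` -/

section Alpha

variable {G : Type*} [Group G] [TopologicalSpace G] [IsTopologicalGroup G]
  {H : Subgroup G} [hH : IsClosed (H : Set G)]

/-- The function `h ↦ f(g⁻¹ h)` on `H`. -/
def slice (f : Hecke G) (g : G) : Hecke H :=
  f.comp (fun h : H => g⁻¹ * (h : G))
    ((Homeomorph.mulLeft g⁻¹).isClosedEmbedding.comp hH.isClosedEmbedding_subtypeVal)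

@[simp] lemma slice_apply (f : Hecke G) (g : G) (h : H) : slice f g h = f (g⁻¹ * (h : G)) := rfl

/-- Moving `g` slightly is a small left translation of `f`, under which `f` is uniformly invariant.
This gives local constancy of `α(f ⊗ w)`. -/
lemma eventually_slice_eq (f : Hecke G) (g : G) :
    ∀ᶠ y in 𝓝 g, slice (H := H) f y = slice f g := by
  have ht : Filter.Tendsto (fun y : G => y⁻¹ * g) (𝓝 g) (𝓝 1) := by
    have : Continuous fun y : G => y⁻¹ * g := by fun_prop
    simpa using this.tendsto g
  filter_upwards [ht.eventually f.eventually_left_invariant] with y hy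
  refine DFunLike.ext _ _ fun h => ?_
  rw [slice_apply, slice_apply, ← hy (g⁻¹ * (h : G)), mul_assoc y⁻¹, mul_inv_cancel_left]

/-- Combined with `heckeAct_conv`, this is why `α` respects the tensor relations. -/
lemma slice_rightAct [T2Space G] [MeasurableSpace G] (ν : Measure H) (f : Hecke G) (φ : Hecke H)
    (g : G) : slice (rightAct ν f φ) g = conv ν (slice f g) φ := by
  refine DFunLike.ext _ _ fun h => ?_
  change ∫ x : H, f (g⁻¹ * (h : G) * (x : G)⁻¹) * φ x ∂ν =
    ∫ x : H, f (g⁻¹ * ((h : G) * (x : G)⁻¹)) * φ x ∂ν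
  simp only [mul_assoc]

variable [LocallyCompactSpace G] [T2Space G] [TotallyDisconnectedSpace G]
  [MeasurableSpace G] [BorelSpace G] {W : Type*} [AddCommGroup W] [Module ℂ W]
  (ν : Measure H) [IsFiniteMeasureOnCompacts ν] [ν.IsOpenPosMeasure] [ν.IsMulRightInvariant]
  {σ : Representation ℂ H W}

/-- The substitution `h ↦ h⁻¹` rewrites `α` as the action of a slice of `f`. -/
lemma alphaFun_eq_heckeAct (hσ : IsSmoothRep σ) (f : Hecke G) (w : W) (g : G) :
    alphaFun ν σ f w g = (modChar G g)⁻¹ • heckeAct ν σ (slice f g) w := by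
  have hδ := modChar_isLocallyConstant ν
  have hinv : Topology.IsClosedEmbedding fun h : H => h⁻¹ := (Homeomorph.inv H).isClosedEmbedding
  let Φ := (slice (H := H) f g).mulLC _ hδ
  rw [alphaFun]
  congr 1
  refine eq_of_forall_dual fun l => ?_
  rw [dual_heckeAct ν hσ, dual_lcIntegral ν
    (F := fun h : H => (f (g⁻¹ * (h : G)⁻¹) * modChar H h⁻¹) • σ h⁻¹ w)
    ((isLocallyConstant_smul_orbit hσ Φ w).comp_continuous hinv.continuous)
    ((Φ.hasCompactSupport.comp_isClosedEmbedding hinv).smul_right)]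
  -- `Φ` carries the factor `δ_H`, which cancels the `δ_H⁻¹` produced by inversion.
  have h1 := integral_inv_eq_integral_modChar ν (Φ.mulLC _ (hσ.isLocallyConstant_dual l w))
  simp only [Hecke.mulLC_apply, map_smul, smul_eq_mul] at h1 ⊢
  refine h1.trans ?_
  congr 1
  ext h
  have := modChar_ne_zero h
  simp only [Φ, Hecke.mulLC_apply]
  field_simp

/-- Left translation by `k ∈ H` translates the slice, giving `δ_H(k) σ(k)`, while the prefactor
gives `δ_G(k)⁻¹`. A nonzero slice at `g` means that `g⁻¹ h` is in the support of `f` for some `h ∈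
H`, so `g ∈ H · (supp f)⁻¹`. -/
lemma alphaFun_mem (μ : Measure G) [IsFiniteMeasureOnCompacts μ]
    [μ.IsOpenPosMeasure] [μ.IsMulRightInvariant] (hσ : IsSmoothRep σ) (f : Hecke G) (w : W) :
    alphaFun ν σ f w ∈ cInd (twist σ (modQuot H)) := by
  refine ⟨fun k g => ?_, ?_, (tsupport (f : G → ℂ))⁻¹, f.hasCompactSupport.isCompact.inv, ?_⟩
  · rw [alphaFun_eq_heckeAct ν hσ, alphaFun_eq_heckeAct ν hσ,
      heckeAct_translate ν hσ (slice f g) _ k (fun h => by simp [mul_assoc])]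
    change _ = (modChar H k / modChar G k) • σ k _
    rw [map_smul, smul_smul, smul_smul, map_mul, mul_inv, div_eq_mul_inv]
    congr 1
    ring
  · rw [IsLocallyConstant.iff_eventually_eq]
    intro g
    filter_upwards [eventually_slice_eq (H := H) f g,
      (modChar_isLocallyConstant μ).eventually_eq g]
      with y h1 h2
    rw [alphaFun_eq_heckeAct ν hσ, alphaFun_eq_heckeAct ν hσ, h1, h2]
  · intro g hg
    rw [Function.mem_support, alphaFun_eq_heckeAct ν hσ] at hg
    obtain ⟨h, hh⟩ : ∃ h : H, f (g⁻¹ * (h : G)) ≠ 0 := by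
      by_contra! hn
      apply hg
      rw [heckeAct_of_forall_eq ν hσ (slice f g) (v' := 0) fun x hx => absurd (hn x) hx,
        smul_zero, smul_zero]
    exact ⟨h, h.2, (g⁻¹ * (h : G))⁻¹, Set.inv_mem_inv.mpr (subset_tsupport _ hh), by simp⟩

variable (μ : Measure G) [IsFiniteMeasureOnCompacts μ] [μ.IsOpenPosMeasure]
  [μ.IsMulRightInvariant]

/-- The map `f ⊗ w ↦ α(f ⊗ w)` on `𝓗(G) ⊗_ℂ W`. -/
def alphaTensor (hσ : IsSmoothRep σ) :
    Hecke G ⊗[ℂ] W →ₗ[ℂ] cInd (twist σ (modQuot H)) :=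
  TensorProduct.lift <| LinearMap.mk₂ ℂ
    (fun f w => ⟨alphaFun ν σ f w, alphaFun_mem ν μ hσ f w⟩)
    (fun f f' w => Subtype.ext <| funext fun g => by
      change alphaFun ν σ (f + f') w g = alphaFun ν σ f w g + alphaFun ν σ f' w g
      simp only [alphaFun_eq_heckeAct ν hσ, ← heckeActBilin_apply ν hσ]
      rw [show slice (f + f') g = slice (H := H) f g + slice f' g from rfl, map_add,
        LinearMap.add_apply, smul_add])
    (fun c f w => Subtype.ext <| funext fun g => by
      change alphaFun ν σ (c • f) w g = c • alphaFun ν σ f w g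
      simp only [alphaFun_eq_heckeAct ν hσ, ← heckeActBilin_apply ν hσ]
      rw [show slice (c • f) g = c • slice (H := H) f g from rfl, map_smul,
        LinearMap.smul_apply, smul_comm])
    (fun f w w' => Subtype.ext <| funext fun g => by
      change alphaFun ν σ f (w + w') g = alphaFun ν σ f w g + alphaFun ν σ f w' g
      simp only [alphaFun_eq_heckeAct ν hσ, ← heckeActBilin_apply ν hσ]
      rw [map_add, smul_add])
    (fun c f w => Subtype.ext <| funext fun g => by
      change alphaFun ν σ f (c • w) g = c • alphaFun ν σ f w g
      simp only [alphaFun_eq_heckeAct ν hσ, ← heckeActBilin_apply ν hσ]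
      rw [map_smul, smul_comm])

/-- The map `α` on `𝓗(G) ⊗_{𝓗(H)} W`. -/
def alphaMap (hσ : IsSmoothRep σ) :
    HeckeTensor (G := G) ν σ →ₗ[ℂ] cInd (twist σ (modQuot H)) :=
  (tensorRel ν σ).liftQ (alphaTensor ν μ hσ) <| by
    rw [tensorRel, Submodule.span_le]
    rintro _ ⟨f, φ, w, rfl⟩
    change alphaTensor ν μ hσ _ = 0
    rw [map_sub, sub_eq_zero]
    refine Subtype.ext <| funext fun g => ?_
    change alphaFun ν σ (rightAct ν f φ) w g = alphaFun ν σ f (heckeAct ν σ φ w) g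
    rw [alphaFun_eq_heckeAct ν hσ, alphaFun_eq_heckeAct ν hσ, slice_rightAct,
      heckeAct_conv ν hσ]

lemma alphaMap_tmulH (hσ : IsSmoothRep σ) (f : Hecke G) (w : W) (g : G) :
    (alphaMap ν μ hσ (tmulH ν σ f w) : G → W) g = alphaFun ν σ f w g := rfl

lemma alphaMap_tmulH_eq_heckeAct (hσ : IsSmoothRep σ) (f : Hecke G) (w : W) (g : G) :
    (alphaMap ν μ hσ (tmulH ν σ f w) : G → W) g =
      (modChar G g)⁻¹ • heckeAct ν σ (slice f g) w :=
  alphaFun_eq_heckeAct ν hσ f w g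

/-- `α` is a homomorphism of `𝓗(G)`-modules. -/
lemma alphaMap_tensorAct (hσ : IsSmoothRep σ) (f' : Hecke G) (x : HeckeTensor (G := G) ν σ) :
    alphaMap ν μ hσ (tensorAct μ ν σ f' x) =
      heckeAct μ (cIndRep (twist σ (modQuot H))) f' (alphaMap ν μ hσ x) := by
  have hτ := cIndRep_isSmooth (twist σ (modQuot H))
  induction x using heckeTensor_induction with
  | h0 => rw [map_zero, map_zero, ← heckeActBilin_apply μ hτ, map_zero]
  | ha x y hx hy =>
    rw [map_add, map_add, map_add, hx, hy]
    simp only [← heckeActBilin_apply μ hτ, map_add]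
  | ht f w =>
    refine Subtype.ext <| funext fun g => eq_of_forall_dual fun l => ?_
    -- Evaluation at `g` followed by `l` is a functional on the induced space, so its action
    -- integral becomes a scalar integral over `G`.
    have hR := dual_heckeAct μ hτ f' (alphaMap ν μ hσ (tmulH ν σ f w))
      (l ∘ₗ LinearMap.proj g ∘ₗ (cInd (twist σ (modQuot H))).subtype)
    change l ((heckeAct μ (cIndRep (twist σ (modQuot H))) f'
      (alphaMap ν μ hσ (tmulH ν σ f w))).1 g) =
      ∫ x, f' x * l ((alphaMap ν μ hσ (tmulH ν σ f w) : G → W) (g * x)) ∂μ at hR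
    rw [hR]
    change l ((alphaMap ν μ hσ (tmulH ν σ (conv μ f' f) w) : G → W) g) = _
    simp only [alphaMap_tmulH_eq_heckeAct, map_smul, dual_heckeAct ν hσ, slice_apply,
      smul_eq_mul, conv_apply_eq]
    obtain ⟨c, hc⟩ : ∃ c : H → ℂ, ∀ h, l (σ h w) = c h := ⟨_, fun _ => rfl⟩
    have h1 := f.continuous
    have h2 := f'.continuous
    have h3 : Continuous c := by
      simpa only [hc] using (hσ.isLocallyConstant_dual l w).continuous
    obtain ⟨d, hd⟩ : ∃ d : G → ℂ, ∀ x, (modChar G x)⁻¹ = d x := ⟨_, fun _ => rfl⟩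
    have h4 : Continuous d := by
      simpa only [hd, Function.comp_def] using
        ((modChar_isLocallyConstant μ).comp (·⁻¹)).continuous
    have hdm : ∀ x y, d (x * y) = d x * d y := fun x y => by
      rw [← hd, ← hd, ← hd, map_mul, mul_inv]
    simp only [hc, hd, hdm, mul_inv_rev, ← integral_const_mul, ← integral_mul_const]
    -- Both sides are now the same double integral over `H` and `G` in opposite orders. The variable
    -- `h` is confined to `H ∩ g · supp f' · supp f`, compact because `H` is closed.
    refine (integral_integral_swap_of_hasCompactSupport (by fun_prop) ?_).trans ?_
    · refine HasCompactSupport.intro ((hH.isClosedEmbedding_subtypeVal.isCompact_preimage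
        ((isCompact_singleton (x := g)).mul (f'.hasCompactSupport.isCompact.mul
          f.hasCompactSupport.isCompact))).prod f'.hasCompactSupport) ?_
      rintro ⟨h, x⟩ hxh
      simp only [Function.uncurry]
      by_cases hx : x ∈ tsupport (f' : G → ℂ)
      · rw [image_eq_zero_of_notMem_tsupport (f := f) fun hy => hxh
          ⟨⟨g, rfl, _, ⟨x, hx, _, hy, rfl⟩, by simp⟩, hx⟩]
        ring
      · rw [image_eq_zero_of_notMem_tsupport hx]
        ring
    · congr 1
      ext x
      congr 1
      ext h
      rw [mul_assoc x⁻¹]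
      ring

end Alpha

/-! ### Tensors indexed by double cosets -/

section DoubleCosetSum

variable {G : Type*} [Group G] [TopologicalSpace G] [IsTopologicalGroup G] [T2Space G]
  [MeasurableSpace G] {H K : Subgroup G} (ho : IsOpen (K : Set G)) (hc : IsCompact (K : Set G))
  {W : Type*} [AddCommGroup W] [Module ℂ W] (ν : Measure H) (σ : Representation ℂ H W)

/-- The map sending a family `(w_d)` indexed by `K \ G / H` to `∑ 1_{K x_d} ⊗ w_d`, where `x_d`
represents `d`. -/
def doubleCosetSum : (DoubleCoset.Quotient (K : Set G) (H : Set G) →₀ W) →ₗ[ℂ]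
    HeckeTensor (G := G) ν σ :=
  Finsupp.lsum ℂ fun d => tmulHBilin ν σ (cosetInd K ho hc d.out)

lemma doubleCosetSum_single (d : DoubleCoset.Quotient (K : Set G) (H : Set G)) (w : W) :
    doubleCosetSum ho hc ν σ (Finsupp.single d w) = tmulH ν σ (cosetInd K ho hc d.out) w := by
  rw [doubleCosetSum, Finsupp.lsum_single, tmulHBilin_apply]

end DoubleCosetSum

/-! ### Bijectivity of `α` -/

section Bijective

variable {G : Type*} [Group G] {H : Subgroup G}

/-- The subgroup `H ∩ x⁻¹ K x` of `H`. -/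
def conjInter (H K : Subgroup G) (x : G) : Subgroup H :=
  K.comap ((MulAut.conj x).toMonoidHom.comp H.subtype)

lemma mem_conjInter {K : Subgroup G} {x : G} {h : H} :
    h ∈ conjInter H K x ↔ x * (h : G) * x⁻¹ ∈ K := Iff.rfl

variable [TopologicalSpace G] [IsTopologicalGroup G]

/-- `C` meets only finitely many cosets `cK`, and `F(x_d⁻¹) ≠ 0` places `x_d⁻¹` in some `H c K`, so
that `d = K c⁻¹ H`. -/
lemma finite_setOf_out_inv_ne_zero {K : Subgroup G} (ho : IsOpen (K : Set G)) {W : Type*} [Zero W]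
    {F : G → W} {C : Set G}
    (hC : IsCompact C) (hF : Function.support F ⊆ (H : Set G) * C) :
    {d : DoubleCoset.Quotient (K : Set G) (H : Set G) | F d.out⁻¹ ≠ 0}.Finite := by
  classical
  obtain ⟨t, ht⟩ := hC.elim_finite_subcover (fun x : G => {g : G | x⁻¹ * g ∈ K})
    (fun x => ho.preimage (continuous_const_mul x⁻¹))
    (fun g _ => Set.mem_iUnion.mpr ⟨g, by simp [K.one_mem]⟩)
  refine (t.image fun c => DoubleCoset.mk K H c⁻¹).finite_toSet.subset ?_
  intro d hd
  obtain ⟨h, hh, c', hc', e⟩ := hF hd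
  obtain ⟨c, hct, hk⟩ := Set.mem_iUnion₂.mp (ht hc')
  refine Finset.mem_image.mpr ⟨c, hct, ?_⟩
  rw [← DoubleCoset.out_eq' K H d, DoubleCoset.eq]
  refine ⟨_, K.inv_mem hk, _, H.inv_mem hh, ?_⟩
  have e' : d.out = (h * c')⁻¹ := by rw [← inv_inv d.out]; exact congrArg _ e.symm
  rw [e']
  group

lemma isClosedEmbedding_conj [hH : IsClosed (H : Set G)] (x : G) :
    IsClosedEmbedding fun h : H => x * (h : G) * x⁻¹ :=
  ((Homeomorph.mulRight x⁻¹).isClosedEmbedding.comp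
    (Homeomorph.mulLeft x).isClosedEmbedding).comp hH.isClosedEmbedding_subtypeVal

variable [hH : IsClosed (H : Set G)] {K : Subgroup G}

lemma isOpen_conjInter (ho : IsOpen (K : Set G)) (x : G) :
    IsOpen (conjInter H K x : Set H) :=
  ho.preimage (isClosedEmbedding_conj x).continuous

lemma isCompact_conjInter (hc : IsCompact (K : Set G)) (x : G) :
    IsCompact (conjInter H K x : Set H) :=
  (isClosedEmbedding_conj x).isCompact_preimage hc

variable [T2Space G]

/-- Identifies the operator through which `α(1_{Kx} ⊗ w)` is evaluated at `x⁻¹`: unnormalized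
averaging over `H ∩ x⁻¹Kx`. -/
lemma slice_cosetInd (ho : IsOpen (K : Set G)) (hc : IsCompact (K : Set G)) (x : G) :
    slice (cosetInd K ho hc x) x⁻¹ =
      Hecke.ind (conjInter H K x : Set H) (isOpen_conjInter ho x) (isCompact_conjInter hc x) := by
  refine DFunLike.ext _ _ fun h => ?_
  rw [slice_apply, inv_inv]
  by_cases hh : h ∈ conjInter H K x
  · rw [Hecke.ind_of_mem _ _ hh, cosetInd_of_mem ho hc (mem_conjInter.mp hh)]
  · rw [Hecke.ind_of_notMem _ _ hh, cosetInd_of_notMem ho hc fun h' => hh (mem_conjInter.mpr h')]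

lemma integral_slice_cosetInd_ne_zero [MeasurableSpace G] [BorelSpace G] (ν : Measure H)
    [IsFiniteMeasureOnCompacts ν] [ν.IsOpenPosMeasure] (ho : IsOpen (K : Set G))
    (hc : IsCompact (K : Set G)) (x : G) :
    ∫ h, slice (cosetInd K ho hc x) x⁻¹ h ∂ν ≠ 0 := by
  rw [slice_cosetInd]
  exact Hecke.integral_ind_ne_zero ν _ _ ⟨1, Subgroup.one_mem _⟩

lemma mem_conjInter_of_slice_ne_zero {ho : IsOpen (K : Set G)} {hc : IsCompact (K : Set G)}
    {x : G} {h : H} (hh : slice (cosetInd K ho hc x) x⁻¹ h ≠ 0) : h ∈ conjInter H K x := by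
  by_contra hn
  rw [slice_cosetInd] at hh
  exact hh (Hecke.ind_of_notMem _ _ hn)

/-- `δ_H` is trivial on the compact open subgroup `H ∩ x⁻¹Kx` of `H`; `δ_G` is conjugation invariant
and trivial on `K`. Hence the twist does not affect invariants under this subgroup. -/
lemma modQuot_eq_one_of_mem [LocallyCompactSpace G] [MeasurableSpace G] [BorelSpace G]
    (ν : Measure H) [IsFiniteMeasureOnCompacts ν]
    [ν.IsOpenPosMeasure] [ν.IsMulRightInvariant] (μ : Measure G) [IsFiniteMeasureOnCompacts μ]
    [μ.IsOpenPosMeasure] [μ.IsMulRightInvariant] {K : Subgroup G} (ho : IsOpen (K : Set G))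
    (hc : IsCompact (K : Set G)) {x : G} {h : H}
    (hh : h ∈ conjInter H K x) : modQuot H h = 1 := by
  have h1 : modChar H h = 1 :=
    modChar_eq_one_of_mem ν (isOpen_conjInter ho x) (isCompact_conjInter hc x) hh
  have h2 : modChar G h = 1 := by
    have h3 := modChar_eq_one_of_mem μ ho hc (mem_conjInter.mp hh)
    rwa [map_mul, map_mul, modChar_inv, mul_right_comm, mul_inv_cancel₀ (modChar_ne_zero x),
      one_mul] at h3
  change modChar H h / modChar G h = 1
  rw [h1, h2, div_one]

variable [LocallyCompactSpace G] [TotallyDisconnectedSpace G]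
  [MeasurableSpace G] [BorelSpace G] {W : Type*} [AddCommGroup W] [Module ℂ W]
  (ν : Measure H) [IsFiniteMeasureOnCompacts ν] [ν.IsOpenPosMeasure]
  {σ : Representation ℂ H W} (ho : IsOpen (K : Set G)) (hc : IsCompact (K : Set G))

/-- The chosen representative of `KxH` is `kxh`: the factor `k` does not change the coset, and `h`
passes through the tensor sign onto `w`. -/
lemma tmulH_cosetInd_mem_range (hσ : IsSmoothRep σ) (x : G) (w : W) :
    tmulH ν σ (cosetInd K ho hc x) w ∈ LinearMap.range (doubleCosetSum ho hc ν σ) := by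
  obtain ⟨k, h, hk, hh, e⟩ := DoubleCoset.mk_out_eq_mul K H x
  refine ⟨Finsupp.single (DoubleCoset.mk K H x) (σ (⟨h, hh⟩⁻¹ : H) w), ?_⟩
  rw [doubleCosetSum_single, e]
  refine (tmulH_translate ν hσ _ _ _ (fun g => ?_) w).symm
  have hiff : g * ((⟨h, hh⟩⁻¹ : H) : G)⁻¹ * (k * x * h)⁻¹ ∈ K ↔ g * x⁻¹ ∈ K := by
    have : g * ((⟨h, hh⟩⁻¹ : H) : G)⁻¹ * (k * x * h)⁻¹ = g * x⁻¹ * k⁻¹ := by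
      simp [mul_assoc]
    rw [this]
    exact K.mul_mem_cancel_right (K.inv_mem hk)
  by_cases hg : g * x⁻¹ ∈ K
  · rw [cosetInd_of_mem ho hc hg, cosetInd_of_mem ho hc (hiff.mpr hg)]
  · rw [cosetInd_of_notMem ho hc hg, cosetInd_of_notMem ho hc (hg ∘ hiff.mp)]

/-- Every element of `𝓗(G) ⊗_{𝓗(H)} W` comes from a family indexed by `K \ G / H`, for `K` small
enough. -/
lemma exists_doubleCosetSum (hσ : IsSmoothRep σ) (x : HeckeTensor (G := G) ν σ) :
    ∃ s ∈ 𝓝 (1 : G), ∀ (K : Subgroup G) (ho : IsOpen (K : Set G)) (hc : IsCompact (K : Set G)),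
      (K : Set G) ⊆ s → x ∈ LinearMap.range (doubleCosetSum ho hc ν σ) := by
  induction x using heckeTensor_induction with
  | h0 => exact ⟨_, Filter.univ_mem, fun K ho hc _ => Submodule.zero_mem _⟩
  -- The claim covers all sufficiently small `K`, so a common `K` serves both summands.
  | ha x y hx hy =>
    obtain ⟨s, hs, h1⟩ := hx
    obtain ⟨t, ht, h2⟩ := hy
    exact ⟨s ∩ t, Filter.inter_mem hs ht, fun K ho hc hK => Submodule.add_mem _
      (h1 K ho hc (hK.trans Set.inter_subset_left))
      (h2 K ho hc (hK.trans Set.inter_subset_right))⟩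
  | ht f w =>
    refine ⟨_, f.eventually_left_invariant, fun K ho hc hK => ?_⟩
    have hspan := mem_span_cosetInd ho hc f fun k hk => hK hk
    have hle : Submodule.span ℂ (Set.range (cosetInd K ho hc)) ≤
        (LinearMap.range (doubleCosetSum ho hc ν σ)).comap ((tmulHBilin ν σ).flip w) := by
      rw [Submodule.span_le]
      rintro _ ⟨x, rfl⟩
      exact tmulH_cosetInd_mem_range ν ho hc hσ x w
    exact hle hspan

variable [ν.IsMulRightInvariant]
  (μ : Measure G) [IsFiniteMeasureOnCompacts μ] [μ.IsOpenPosMeasure] [μ.IsMulRightInvariant]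

/-- The value of `α(∑ 1_{K x_d} ⊗ w_d)` at `x_d⁻¹`. -/
lemma alphaMap_doubleCosetSum (hσ : IsSmoothRep σ)
    (v : DoubleCoset.Quotient (K : Set G) (H : Set G) →₀ W)
    (d : DoubleCoset.Quotient (K : Set G) (H : Set G)) :
    (alphaMap ν μ hσ (doubleCosetSum ho hc ν σ v) : G → W) d.out⁻¹ =
      (modChar G d.out⁻¹)⁻¹ •
        heckeAct ν σ (slice (cosetInd K ho hc d.out) d.out⁻¹) (v d) := by
  induction v using Finsupp.induction_linear with
  | zero =>
    rw [map_zero, map_zero, Finsupp.zero_apply, ← heckeActBilin_apply ν hσ, map_zero, smul_zero]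
    rfl
  | add a b ha hb =>
    rw [map_add, map_add, Finsupp.add_apply, ← heckeActBilin_apply ν hσ, map_add, smul_add]
    exact congrArg₂ (· + ·) ha hb
  | single e w =>
    rw [doubleCosetSum_single, alphaMap_tmulH_eq_heckeAct]
    by_cases hde : e = d
    · subst hde
      rw [Finsupp.single_eq_same]
    -- For `e ≠ d` the slice vanishes identically: a nonzero value at `h` would put `x_d h` in `K
    -- x_e` and make the double cosets equal.
    · rw [Finsupp.single_eq_of_ne (Ne.symm hde), heckeAct_of_forall_eq ν hσ _ (v := w) (v' := 0),
        heckeAct_of_forall_eq ν hσ _ (v := 0) (v' := 0) fun x _ => map_zero _]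
      · simp only [smul_zero]
      intro h hh
      exfalso
      apply hde
      rw [slice_apply, inv_inv] at hh
      have hK : d.out * (h : G) * e.out⁻¹ ∈ K := by
        by_contra hn
        exact hh (cosetInd_of_notMem ho hc hn)
      rw [← DoubleCoset.out_eq' K H e, ← DoubleCoset.out_eq' K H d, DoubleCoset.eq]
      exact ⟨_, hK, _, H.inv_mem h.2, by group⟩

lemma alphaMap_injective (hσ : IsSmoothRep σ) : Function.Injective (alphaMap (G := G) ν μ hσ) := by
  rw [← LinearMap.ker_eq_bot, LinearMap.ker_eq_bot']
  intro x hx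
  obtain ⟨s, hs, hxs⟩ := exists_doubleCosetSum ν hσ x
  obtain ⟨K, ho, hc, hK⟩ := exists_compact_open_subgroup hs
  obtain ⟨v, rfl⟩ := hxs K ho hc hK
  rw [doubleCosetSum, Finsupp.lsum_apply]
  refine Finset.sum_eq_zero fun d _ => ?_
  have h0 : heckeAct ν σ (slice (cosetInd K ho hc d.out) d.out⁻¹) (v d) = 0 := by
    have h := alphaMap_doubleCosetSum ν ho hc μ hσ v d
    rw [hx] at h
    exact (smul_eq_zero.mp h.symm).resolve_left (inv_ne_zero (modChar_ne_zero _))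
  -- With φ the indicator of `H ∩ x_d⁻¹Kx_d`, the function 1_{Kx_d} φ is vol · 1_{Kx_d}, so vol ·
  -- (1_{Kx_d} ⊗ w_d) = 1_{Kx_d} ⊗ φ w_d = 0.
  have h1 := tmulH_rightAct ν σ (cosetInd K ho hc d.out)
    (slice (cosetInd K ho hc d.out) d.out⁻¹) (v d)
  rw [h0, rightAct_of_forall_eq ν _ (cosetInd K ho hc d.out) _,
    ← tmulHBilin_apply, ← tmulHBilin_apply, map_zero, map_smul, LinearMap.smul_apply] at h1
  · exact (smul_eq_zero.mp h1).resolve_left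
      (integral_slice_cosetInd_ne_zero ν ho hc d.out)
  · intro h hh g
    have hmem := mem_conjInter.mp (mem_conjInter_of_slice_ne_zero hh)
    have hiff : g * (h : G)⁻¹ * d.out⁻¹ ∈ K ↔ g * d.out⁻¹ ∈ K := by
      rw [← K.mul_mem_cancel_right hmem]
      simp [mul_assoc]
    by_cases hg : g * d.out⁻¹ ∈ K
    · rw [cosetInd_of_mem ho hc hg, cosetInd_of_mem ho hc (hiff.mpr hg)]
    · rw [cosetInd_of_notMem ho hc hg, cosetInd_of_notMem ho hc (hg ∘ hiff.mp)]

/-- Left `K`-invariance of 1_{Kx_d} becomes right invariance in `g` because the slice involves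
`g⁻¹`; the prefactor is unchanged since `δ_G` is trivial on `K`. -/
lemma alphaMap_doubleCosetSum_mul (hσ : IsSmoothRep σ)
    (v : DoubleCoset.Quotient (K : Set G) (H : Set G) →₀ W) (g : G) {k : G} (hk : k ∈ K) :
    (alphaMap ν μ hσ (doubleCosetSum ho hc ν σ v) : G → W) (g * k) =
      (alphaMap ν μ hσ (doubleCosetSum ho hc ν σ v) : G → W) g := by
  induction v using Finsupp.induction_linear with
  | zero => rw [map_zero, map_zero]; rfl
  | add a b ha hb =>
    rw [map_add, map_add]
    exact congrArg₂ (· + ·) ha hb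
  | single e w =>
    rw [doubleCosetSum_single, alphaMap_tmulH_eq_heckeAct, alphaMap_tmulH_eq_heckeAct, map_mul,
      modChar_eq_one_of_mem μ ho hc hk, mul_one]
    congr 2
    refine DFunLike.ext _ _ fun h => ?_
    rw [slice_apply, slice_apply]
    have hiff : (g * k)⁻¹ * (h : G) * e.out⁻¹ ∈ K ↔ g⁻¹ * (h : G) * e.out⁻¹ ∈ K := by
      rw [← K.mul_mem_cancel_left hk]
      simp [mul_assoc]
    by_cases hg : g⁻¹ * (h : G) * e.out⁻¹ ∈ K
    · rw [cosetInd_of_mem ho hc hg, cosetInd_of_mem ho hc (hiff.mpr hg)]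
    · rw [cosetInd_of_notMem ho hc hg, cosetInd_of_notMem ho hc (hg ∘ hiff.mp)]

lemma alphaMap_surjective (hσ : IsSmoothRep σ) :
    Function.Surjective (alphaMap (G := G) ν μ hσ) := by
  intro F
  have hopen := cIndRep_isSmooth (twist σ (modQuot H)) F
  obtain ⟨K, ho, hc, hK⟩ := exists_compact_open_subgroup (hopen.mem_nhds (x := 1) (by simp))
  have hFK : ∀ k ∈ K, ∀ g, (F : G → W) (g * k) = (F : G → W) g := fun k hk g =>
    congrFun (congrArg Subtype.val (hK hk)) g
  obtain ⟨hFH, -, C, hC, hFC⟩ := F.2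
  have hfin := finite_setOf_out_inv_ne_zero (K := K) ho hC hFC
  -- The inverse volume normalizes the averaging over `H ∩ x_d⁻¹Kx_d`; the modular factor cancels
  -- the prefactor of `α` at `x_d⁻¹`.
  let c : DoubleCoset.Quotient (K : Set G) (H : Set G) → ℂ := fun d =>
    (∫ h, slice (cosetInd K ho hc d.out) d.out⁻¹ h ∂ν)⁻¹ * modChar G d.out⁻¹
  let v : DoubleCoset.Quotient (K : Set G) (H : Set G) →₀ W :=
    Finsupp.ofSupportFinite (fun d => c d • (F : G → W) d.out⁻¹)
      (hfin.subset fun d hd h0 => hd (by simp only [h0, smul_zero]))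
  have hv : ∀ d, v d = c d • (F : G → W) d.out⁻¹ := fun d => rfl
  refine ⟨doubleCosetSum ho hc ν σ v, ?_⟩
  have hout : ∀ d : DoubleCoset.Quotient (K : Set G) (H : Set G),
      (alphaMap ν μ hσ (doubleCosetSum ho hc ν σ v) : G → W) d.out⁻¹ = (F : G → W) d.out⁻¹ := by
    intro d
    rw [alphaMap_doubleCosetSum, heckeAct_of_forall_eq ν hσ _ (v' := v d), hv, smul_smul,
      smul_smul]
    · have h1 := integral_slice_cosetInd_ne_zero ν ho hc d.out
      have h2 := modChar_ne_zero d.out⁻¹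
      simp only [c]
      rw [← mul_assoc, mul_assoc (modChar G d.out⁻¹)⁻¹, mul_inv_cancel₀ h1, mul_one,
        inv_mul_cancel₀ h2, one_smul]
    -- `F(x_d⁻¹)` is fixed by `σ(h)`: `h x_d⁻¹ = x_d⁻¹ (x_d h x_d⁻¹)` with `x_d h x_d⁻¹ ∈ K`, and
    -- the twist is trivial at `h`.
    · intro h hh
      have hmem := mem_conjInter_of_slice_ne_zero hh
      have h1 := hFH h d.out⁻¹
      change _ = modQuot H h • σ h _ at h1
      rw [modQuot_eq_one_of_mem ν μ ho hc hmem, one_smul] at h1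
      rw [hv, map_smul, ← h1, ← hFK _ (mem_conjInter.mp hmem) d.out⁻¹]
      congr 2
      group
  refine Subtype.ext <| funext fun g => ?_
  -- `G` is the union of the sets `H x_d⁻¹ K`, so agreement at the points `x_d⁻¹` spreads to all of
  -- `G` by equivariance under `H` and invariance under `K`.
  obtain ⟨k, h, hk, hh, e⟩ := DoubleCoset.mk_out_eq_mul K H g⁻¹
  set d := DoubleCoset.mk K H g⁻¹
  have hg : g = ((⟨h, hh⟩ : H) : G) * (d.out⁻¹ * k) := by
    rw [e]
    group
  rw [hg, (alphaMap ν μ hσ (doubleCosetSum ho hc ν σ v)).2.1, hFH,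
    alphaMap_doubleCosetSum_mul ν ho hc μ hσ v _ hk, hFK k hk, hout]

end Bijective

end HeckeInduction

end

open MeasureTheory TensorProduct Topology
open scoped Pointwise NNReal
open HeckeInduction
theorem mainTheorem3 {G : Type*} [Group G] [TopologicalSpace G] [IsTopologicalGroup G]
    [LocallyCompactSpace G] [T2Space G] [TotallyDisconnectedSpace G]
    [MeasurableSpace G] [BorelSpace G]
    (μ : Measure G) [IsFiniteMeasureOnCompacts μ] [μ.IsOpenPosMeasure] [μ.IsMulRightInvariant]
    (H : Subgroup G) [hH : IsClosed (H : Set G)]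
    (ν : Measure H) [IsFiniteMeasureOnCompacts ν] [ν.IsOpenPosMeasure] [ν.IsMulRightInvariant]
    {W : Type*} [AddCommGroup W] [Module ℂ W]
    (σ : Representation ℂ H W) (hσ : IsSmoothRep σ) :
    ∃ α : HeckeTensor ν σ ≃ₗ[ℂ] cInd (twist σ (modQuot H)),
      (∀ (f : Hecke G) (w : W) (g : G),
        (α (tmulH ν σ f w) : G → W) g = alphaFun ν σ f w g) ∧
      (∀ (f' : Hecke G) (x : HeckeTensor ν σ),
        α (tensorAct μ ν σ f' x) = heckeAct μ (cIndRep (twist σ (modQuot H))) f' (α x)) :=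
  ⟨LinearEquiv.ofBijective (alphaMap ν μ hσ)
    ⟨alphaMap_injective ν μ hσ, alphaMap_surjective ν μ hσ⟩,
    alphaMap_tmulH ν μ hσ, alphaMap_tensorAct ν μ hσ⟩
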